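/- **Conventions.** A pro-$C^*$-algebra $A$ is a complete Hausdorff topological $*$-algebra whose topology is given by an upward directed family of $C^*$-seminorms $\{p_\lambda\}_{\lambda\in\Lambda}$ (with $p_\mu\le p_\lambda$ for $\mu\le\lambda$). A Hilbert pro-$C^*$-module $X$ over $A$ is a right inner product $A$-module, complete for the seminorms $p^A_\lambda(x)=p_\lambda(\langle x,x\rangle)^{1/2}$. $L_A(X)$ is the $*$-algebra of adjointable operators with the topology of the operator seminorms $\sup\{p^A_\lambda(Tx):p_\lambda^A(x)\le1\}$, and $K_A(X)$ is the closed linear span of the operators $\theta_{y,x}(z)=y\langle x,z\rangle$. A pro-$C^*$-correspondence $(X,A,\varphi_X)$ consists of such $A$, $X$ and a continuous $*$-homomorphism $\varphi_X:A\to L_A(X)$; if $\Lambda$ is a single point it is a $C^*$-correspondence. Put $A_\lambda=A/\ker p_\lambda$, $X_\lambda=X/\ker p^A_\lambda$, with the canonical maps $\pi_\lambda:A\to A_\lambda$, $\sigma_\lambda:X\to X_\lambda$, $\pi_\lambda^{L}:L_A(X)\to L_{A_\lambda}(X_\lambda)$, and, for $\lambda\ge\mu$, $\pi_{\lambda\mu}:A_\lambda\to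 A_\mu$, $\sigma_{\lambda\mu}:X_\lambda\to X_\mu$. Let $$J_X^\lambda=\{a\in A:\ \pi^L_\lambda(\varphi_X(a))\in K_{A_\lambda}(X_\lambda),\ \pi_\lambda(ab)=0\ \text{for all } b\in\ker(\pi_\lambda^L\circ\varphi_X)\},\qquad \mathcal J_X=\bigcap_\lambda J_X^\lambda .$$ For a closed two-sided $*$-ideal $I$ of $A$ let $X(I)=\overline{\mathrm{span}}\{\langle y,\varphi_X(a)x\rangle: a\in I,\ x,y\in X\}$ and $X^{-1}(I)=\{a:\langle y,\varphi_X(a)x\rangle\in I\ \forall x,y\in X\}$. The ideal $I$ is *invariant* if $X(I)\subset I$ and $\pi_\mu(J_X^\lambda)\cap\pi_\mu(X^{-1}(I))\subset\pi_\mu(I)$ for all $\lambda\ge\mu$ in $\Lambda$. A representation $(\pi,t)$ of $(X,A,\varphi_X)$ on a pro-$C^*$-algebra $B$ is a continuous $*$-homomorphism $\pi:A\to B$ and a map $t:X\to B$ with $t(x)^*t(y)=\pi(\langle x,y\rangle)$ and $\pi(a)t(x)=t(\varphi_X(a)x)$. It is covariant if $\psi_t(\varphi_X(a))=\pi(a)$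 for all $a\in\mathcal J_X$, where $\psi_t:K_A(X)\to B$ is the continuous $*$-homomorphism with $\psi_t(\theta_{x,y})=t(x)t(y)^*$. For a $C^*$-correspondence $Y$ over $D$, $\mathcal J_Y$ is $\{a\in D:\varphi_Y(a)\in K(Y),\ ab=0\ \forall b\in\ker\varphi_Y\}$, and $\mathcal O_Y$ denotes the $C^*$-algebra generated by the images of the universal covariant representation $(\pi_Y,t_Y)$ of $Y$ on $C^*$-algebras. **Proposition.** Let $(X,A,\varphi_X)$ be a pro-$C^*$-correspondence such that $\ker p_\lambda$ is invariant for every $\lambda\in\Lambda$. Then: 1. There are $*$-homomorphisms $\varphi_{X_\lambda}:A_\lambda\to L_{A_\lambda}(X_\lambda)$ with $\varphi_{X_\lambda}(\pi_\lambda(a))\sigma_\lambda(x)=\sigma_\lambda(\varphi_X(a)x)$; each $(X_\lambda,A_\lambda,\varphi_{X_\lambda})$ is a $C^*$-correspondence; these form, with the maps $\pi_{\lambda\mu},\sigma_{\lambda\mu}$, an inverse system, and $(X,A,\varphi_X)$ is, through the maps $\pi_\lambda,\sigma_\lambda$, its inverse limit. 2. For every $\lambda$ the universal covariant representation $(\pi_{X_\lambda},t_{X_\lambda})$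 of $X_\lambda$ on $\mathcal O_{X_\lambda}$ exists, and there are $*$-homomorphisms $\rho_{\lambda\mu}:\mathcal O_{X_\lambda}\to\mathcal O_{X_\mu}$ ($\lambda\ge\mu$) with $\rho_{\lambda\mu}\circ\pi_{X_\lambda}=\pi_{X_\mu}\circ\pi_{\lambda\mu}$ and $\rho_{\lambda\mu}\circ t_{X_\lambda}=t_{X_\mu}\circ\sigma_{\lambda\mu}$, which make $\{\mathcal O_{X_\lambda};\rho_{\lambda\mu}\}$ an inverse system of $C^*$-algebras. 3. There is a covariant representation $(\pi,t)$ of $(X,A,\varphi_X)$ on $\varprojlim_\lambda\mathcal O_{X_\lambda}$ with $\pi(a)=(\pi_{X_\lambda}(\pi_\lambda(a)))_\lambda$ and $t(x)=(t_{X_\lambda}(\sigma_\lambda(x)))_\lambda$. -/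

import Mathlib

open Topology
open scoped ENNReal NNReal

universe w u v

namespace ProCStar

noncomputable section

/-- A complex `*`-algebra `A` with a separating family of `C*`-seminorms `p i`, together with a
right inner product `A`-module `X` with its seminorms `q i x = p i ⟪x, x⟫ ^ (1/2)`.
No completeness is required here. For the one-point index type `PUnit` this is a
pre-`C*`-algebra with a right inner product module over it. -/
structure PreHilbertPair (ι : Type w) where
  /-- the algebra -/
  A : Type u
  /-- the module -/
  X : Type v
  [nonUnitalRing : NonUnitalRing A]
  [starRing : StarRing A]
  [moduleA : Module ℂ A]
  [isScalarTower : IsScalarTower ℂ A A]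
  [smulCommClass : SMulCommClass ℂ A A]
  [starModule : StarModule ℂ A]
  [addCommGroup : AddCommGroup X]
  [moduleX : Module ℂ X]
  /-- the `C*`-seminorms -/
  p : ι → Seminorm ℂ A
  p_mul_le : ∀ i a b, p i (a * b) ≤ p i a * p i b
  p_star_mul_self : ∀ i a, p i (star a * a) = p i a ^ 2
  p_separating : ∀ a, (∀ i, p i a = 0) → a = 0
  /-- the right action `(x, a) ↦ x a` -/
  rsmul : X →ₗ[ℂ] A →ₗ[ℂ] X
  rsmul_mul : ∀ x a b, rsmul x (a * b) = rsmul (rsmul x a) b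
  /-- the `A`-valued inner product, linear in the second variable -/
  inner : X → X → A
  inner_add_right : ∀ x y z, inner x (y + z) = inner x y + inner x z
  inner_smul_right : ∀ (c : ℂ) x y, inner x (c • y) = c • inner x y
  inner_rsmul_right : ∀ x y a, inner x (rsmul y a) = inner x y * a
  star_inner : ∀ x y, star (inner x y) = inner y x
  inner_self_nonneg : ∀ x, ∃ b, inner x x = star b * b
  inner_self_eq_zero : ∀ x, inner x x = 0 → x = 0
  /-- the seminorms on the module -/
  q : ι → Seminorm ℂ X
  q_eq : ∀ i x, q i x = Real.sqrt (p i (inner x x))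

namespace PreHilbertPair

attribute [instance] nonUnitalRing starRing moduleA isScalarTower smulCommClass starModule
  addCommGroup moduleX

variable {ι : Type w} (H : PreHilbertPair.{w, u, v} ι)

/-- The uniform structure of `A`, given by the seminorms `p i`. -/
instance uniformSpaceA : UniformSpace H.A :=
  ⨅ i, (H.p i).toAddGroupSeminorm.toSeminormedAddCommGroup.toUniformSpace

/-- The uniform structure of `X`, given by the seminorms `q i`. -/
instance uniformSpaceX : UniformSpace H.X :=
  ⨅ i, (H.q i).toAddGroupSeminorm.toSeminormedAddCommGroup.toUniformSpace

variable {H}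

theorem p_star (i : ι) (a : H.A) : H.p i (star a) = H.p i a := by
  have key : ∀ b : H.A, H.p i b ≤ H.p i (star b) := by
    intro b
    have h1 := H.p_mul_le i (star b) b
    rw [H.p_star_mul_self] at h1
    rcases (apply_nonneg (H.p i) b).eq_or_lt with h | h
    · rw [← h]; exact apply_nonneg _ _
    · nlinarith
  refine le_antisymm ?_ (key a)
  simpa using key (star a)

theorem q_sq (i : ι) (x : H.X) : H.q i x ^ 2 = H.p i (H.inner x x) := by
  rw [H.q_eq, Real.sq_sqrt (apply_nonneg _ _)]

theorem inner_add_left (x y z : H.X) : H.inner (x + y) z = H.inner x z + H.inner y z := by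
  rw [← H.star_inner, H.inner_add_right, star_add, H.star_inner, H.star_inner]

theorem inner_smul_left (c : ℂ) (x y : H.X) : H.inner (c • x) y = star c • H.inner x y := by
  rw [← H.star_inner, H.inner_smul_right, star_smul, H.star_inner]

theorem inner_rsmul_left (x y : H.X) (a : H.A) :
    H.inner (H.rsmul x a) y = star a * H.inner x y := by
  rw [← H.star_inner, H.inner_rsmul_right, star_mul, H.star_inner]

theorem inner_zero_right (x : H.X) : H.inner x 0 = 0 := by
  simpa using H.inner_smul_right 0 x 0

theorem inner_sub_right (x y z : H.X) : H.inner x (y - z) = H.inner x y - H.inner x z := by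
  rw [eq_sub_iff_add_eq, ← H.inner_add_right, sub_add_cancel]

theorem inner_sub_left (x y z : H.X) : H.inner (x - y) z = H.inner x z - H.inner y z := by
  rw [← H.star_inner, inner_sub_right, star_sub, H.star_inner, H.star_inner]

theorem ext_inner {x y : H.X} (h : ∀ z, H.inner z x = H.inner z y) : x = y := by
  rw [← sub_eq_zero]
  apply H.inner_self_eq_zero
  rw [inner_sub_right, h, sub_self]

theorem q_rsmul_le (i : ι) (x : H.X) (a : H.A) : H.q i (H.rsmul x a) ≤ H.q i x * H.p i a := by
  have h0 : 0 ≤ H.q i x * H.p i a := mul_nonneg (apply_nonneg _ _) (apply_nonneg _ _)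
  refine le_of_sq_le_sq ?_ h0
  rw [q_sq, inner_rsmul_left, H.inner_rsmul_right, mul_pow, q_sq]
  calc H.p i (star a * (H.inner x x * a)) ≤ H.p i (star a) * (H.p i (H.inner x x) * H.p i a) :=
        (H.p_mul_le _ _ _).trans
          (mul_le_mul_of_nonneg_left (H.p_mul_le _ _ _) (apply_nonneg _ _))
    _ = H.p i (H.inner x x) * H.p i a ^ 2 := by rw [p_star]; ring

/-- A crude Cauchy–Schwarz inequality, sufficient for the constructions below. -/
theorem p_inner_le (i : ι) (x y : H.X) : H.p i (H.inner x y) ≤ 3 * (H.q i x * H.q i y) := by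
  set a := H.inner x y with ha
  set P := H.p i a with hP
  have hP0 : 0 ≤ P := apply_nonneg _ _
  have hx0 : 0 ≤ H.q i x := apply_nonneg _ _
  have hy0 : 0 ≤ H.q i y := apply_nonneg _ _
  have key : ∀ s : ℝ, 0 ≤ s →
      s * P ^ 2 ≤ (H.q i x * P) ^ 2 + s * (H.q i x * P * H.q i y) + s ^ 2 * H.q i y ^ 2 := by
    intro s hs
    have e1 : H.inner (H.rsmul x a + (s : ℂ) • y) (H.rsmul x a + (s : ℂ) • y)
        = H.inner (H.rsmul x a) (H.rsmul x a) + ((2 * s : ℝ) : ℂ) • (star a * a)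
          + H.inner ((s : ℂ) • y) ((s : ℂ) • y) := by
      have e2 : H.inner (H.rsmul x a) ((s : ℂ) • y) = (s : ℂ) • (star a * a) := by
        rw [inner_rsmul_left, H.inner_smul_right, mul_smul_comm]
      have e3 : H.inner ((s : ℂ) • y) (H.rsmul x a) = (s : ℂ) • (star a * a) := by
        rw [inner_smul_left, H.inner_rsmul_right, ← H.star_inner x y]
        simp [ha]
      rw [H.inner_add_right, inner_add_left, inner_add_left, e2, e3]
      push_cast
      rw [two_mul, add_smul]
      abel
    have e4 : H.p i (((2 * s : ℝ) : ℂ) • (star a * a)) = 2 * s * P ^ 2 := by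
      rw [map_smul_eq_mul, H.p_star_mul_self, Complex.norm_real, Real.norm_eq_abs,
        abs_of_nonneg (by positivity)]
    have e5 : ((2 * s : ℝ) : ℂ) • (star a * a)
        = H.inner (H.rsmul x a + (s : ℂ) • y) (H.rsmul x a + (s : ℂ) • y)
          - H.inner (H.rsmul x a) (H.rsmul x a) - H.inner ((s : ℂ) • y) ((s : ℂ) • y) := by
      rw [e1]; abel
    have e6 : 2 * s * P ^ 2 ≤ H.q i (H.rsmul x a + (s : ℂ) • y) ^ 2
        + H.q i (H.rsmul x a) ^ 2 + H.q i ((s : ℂ) • y) ^ 2 := by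
      rw [← e4, e5, q_sq, q_sq, q_sq]
      exact (map_sub_le_add _ _ _).trans (add_le_add_left (map_sub_le_add _ _ _) _)
    have e7 : H.q i ((s : ℂ) • y) = s * H.q i y := by
      rw [map_smul_eq_mul, Complex.norm_real, Real.norm_eq_abs, abs_of_nonneg hs]
    have e8 : H.q i (H.rsmul x a + (s : ℂ) • y) ≤ H.q i x * P + s * H.q i y :=
      (map_add_le_add _ _ _).trans (add_le_add (q_rsmul_le i x a) e7.le)
    have e9 := q_rsmul_le i x a
    have e10 : H.q i (H.rsmul x a + (s : ℂ) • y) ^ 2 ≤ (H.q i x * P + s * H.q i y) ^ 2 :=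
      pow_le_pow_left₀ (apply_nonneg _ _) e8 2
    have e11 : H.q i (H.rsmul x a) ^ 2 ≤ (H.q i x * P) ^ 2 :=
      pow_le_pow_left₀ (apply_nonneg _ _) e9 2
    rw [e7] at e6
    nlinarith
  rcases hP0.eq_or_lt with h | hPpos
  · rw [← h]; positivity
  rcases hy0.eq_or_lt with h | hypos
  · exfalso
    have := key (H.q i x ^ 2 + 1) (by positivity)
    rw [← h] at this
    nlinarith [pow_pos hPpos 2]
  rcases hx0.eq_or_lt with h | hxpos
  · exfalso
    have := key (P ^ 2 / (2 * H.q i y ^ 2)) (by positivity)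
    rw [← h] at this
    have e : (P ^ 2 / (2 * H.q i y ^ 2)) ^ 2 * H.q i y ^ 2
        = P ^ 2 / (2 * H.q i y ^ 2) * (P ^ 2 / 2) := by
      field_simp
      try ring
    have hs : 0 < P ^ 2 / (2 * H.q i y ^ 2) := by positivity
    nlinarith [pow_pos hPpos 2, mul_pos hs (pow_pos hPpos 2)]
  · have h := key (P * H.q i x / H.q i y) (by positivity)
    have e : (H.q i x * P) ^ 2 + P * H.q i x / H.q i y * (H.q i x * P * H.q i y)
        + (P * H.q i x / H.q i y) ^ 2 * H.q i y ^ 2 = 3 * (H.q i x * H.q i y)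
          * (P ^ 2 * H.q i x / H.q i y) := by
      field_simp
      try ring
    have e' : P * H.q i x / H.q i y * P ^ 2 = P * (P ^ 2 * H.q i x / H.q i y) := by ring
    rw [e, e'] at h
    exact le_of_mul_le_mul_right h (by positivity)

theorem p_inner_eq_zero (i : ι) {x y : H.X} (h : H.q i x = 0 ∨ H.q i y = 0) :
    H.p i (H.inner x y) = 0 := by
  refine le_antisymm ?_ (apply_nonneg _ _)
  have := p_inner_le i x y
  rcases h with h | h <;> simpa [h] using this

variable (H)

/-! ### Adjointable operators -/

/-- The algebra `L_A(X)` of adjointable operators on `X`, inside the linear endomorphisms. -/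
def adjointable : Subalgebra ℂ (Module.End ℂ H.X) where
  carrier := {T | ∃ S : Module.End ℂ H.X, ∀ x y, H.inner (T x) y = H.inner x (S y)}
  mul_mem' := by
    rintro T T' ⟨S, hS⟩ ⟨S', hS'⟩
    exact ⟨S' * S, fun x y => by simp [hS, hS']⟩
  add_mem' := by
    rintro T T' ⟨S, hS⟩ ⟨S', hS'⟩
    exact ⟨S + S', fun x y => by simp [hS, hS', inner_add_left, H.inner_add_right]⟩
  algebraMap_mem' := fun c => ⟨algebraMap ℂ _ (star c), fun x y => by
    simp [Module.algebraMap_end_apply, inner_smul_left, H.inner_smul_right]⟩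

/-- `L_A(X)` as a type. -/
abbrev L : Type v := H.adjointable

variable {H}

theorem exists_adj (T : H.L) :
    ∃ S : H.L, ∀ x y, H.inner (T.1 x) y = H.inner x (S.1 y) := by
  obtain ⟨S, hS⟩ := T.2
  refine ⟨⟨S, T.1, fun x y => ?_⟩, hS⟩
  rw [← H.star_inner, ← hS, H.star_inner]

/-- The adjoint operator. -/
instance starL : Star H.L := ⟨fun T => (exists_adj T).choose⟩

theorem inner_star (T : H.L) (x y : H.X) :
    H.inner (T.1 x) y = H.inner x ((star T).1 y) := (exists_adj T).choose_spec x y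

theorem inner_star' (T : H.L) (x y : H.X) :
    H.inner ((star T).1 x) y = H.inner x (T.1 y) := by
  rw [← H.star_inner, ← inner_star, H.star_inner]

theorem extL {T S : H.L} (h : ∀ x y, H.inner x (T.1 y) = H.inner x (S.1 y)) : T = S :=
  Subtype.ext (LinearMap.ext fun y => ext_inner fun x => h x y)

instance starRingL : StarRing H.L where
  star_involutive T := extL fun x y => by rw [← inner_star, inner_star']
  star_mul T S := extL fun x y => by
    rw [← inner_star]
    change H.inner (T.1 (S.1 x)) y = H.inner x ((star S).1 ((star T).1 y))
    rw [inner_star, inner_star]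
  star_add T S := extL fun x y => by
    rw [← inner_star]
    change H.inner (T.1 x + S.1 x) y = H.inner x ((star T).1 y + (star S).1 y)
    rw [inner_add_left, H.inner_add_right, inner_star, inner_star]

instance starModuleL : StarModule ℂ H.L where
  star_smul c T := extL fun x y => by
    rw [← inner_star]
    change H.inner (c • T.1 x) y = H.inner x (star c • (star T).1 y)
    rw [inner_smul_left, H.inner_smul_right, inner_star]

/-- The operator seminorm `sup {q i (T x) : q i x ≤ 1}`. -/
def opSeminorm (i : ι) (T : H.L) : ℝ≥0∞ :=
  ⨆ (x : H.X) (_ : H.q i x ≤ 1), ENNReal.ofReal (H.q i (T.1 x))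

theorem opSeminorm_le (i : ι) (T : H.L) {C : ℝ} (hC : 0 ≤ C)
    (h : ∀ x, H.q i (T.1 x) ≤ C * H.q i x) : opSeminorm i T ≤ ENNReal.ofReal C := by
  refine iSup₂_le fun x hx => ENNReal.ofReal_le_ofReal ((h x).trans ?_)
  exact mul_le_of_le_one_right hC hx

theorem q_apply_eq_zero (i : ι) (T : H.L) {x : H.X} (hx : H.q i x = 0) : H.q i (T.1 x) = 0 := by
  have h : H.q i (T.1 x) ^ 2 = 0 := by
    rw [q_sq, inner_star]
    exact p_inner_eq_zero i (Or.inl hx)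
  exact pow_eq_zero_iff (two_ne_zero) |>.1 h

theorem q_apply_le (i : ι) (T : H.L) (hT : opSeminorm i T ≠ ∞) (x : H.X) :
    H.q i (T.1 x) ≤ (opSeminorm i T).toReal * H.q i x := by
  rcases (apply_nonneg (H.q i) x).eq_or_lt with h | h
  · rw [q_apply_eq_zero i T h.symm, ← h, mul_zero]
  · have hx : H.q i (((H.q i x)⁻¹ : ℝ) • x : H.X) ≤ 1 := by
      rw [← Complex.coe_smul, map_smul_eq_mul, Complex.norm_real, Real.norm_eq_abs,
        abs_of_nonneg (inv_nonneg.2 h.le), inv_mul_cancel₀ h.ne']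
    have h2 : ENNReal.ofReal (H.q i (T.1 (((H.q i x)⁻¹ : ℝ) • x : H.X))) ≤ opSeminorm i T :=
      le_iSup₂ (f := fun (x : H.X) (_ : H.q i x ≤ 1) => ENNReal.ofReal (H.q i (T.1 x))) _ hx
    have h3 := (ENNReal.ofReal_le_iff_le_toReal hT).1 h2
    rw [← Complex.coe_smul, map_smul, map_smul_eq_mul, Complex.norm_real, Real.norm_eq_abs,
        abs_of_nonneg (inv_nonneg.2 h.le)] at h3
    rwa [inv_mul_le_iff₀ h, mul_comm] at h3

theorem opSeminorm_add_le (i : ι) (T S : H.L) :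
    opSeminorm i (T + S) ≤ opSeminorm i T + opSeminorm i S := by
  refine iSup₂_le fun x hx => ?_
  calc ENNReal.ofReal (H.q i ((T + S).1 x))
      ≤ ENNReal.ofReal (H.q i (T.1 x) + H.q i (S.1 x)) :=
        ENNReal.ofReal_le_ofReal (map_add_le_add (H.q i) (T.1 x) (S.1 x))
    _ = ENNReal.ofReal (H.q i (T.1 x)) + ENNReal.ofReal (H.q i (S.1 x)) :=
        ENNReal.ofReal_add (apply_nonneg _ _) (apply_nonneg _ _)
    _ ≤ _ := add_le_add
        (le_iSup₂ (f := fun (x : H.X) (_ : H.q i x ≤ 1) => ENNReal.ofReal (H.q i (T.1 x))) x hx)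
        (le_iSup₂ (f := fun (x : H.X) (_ : H.q i x ≤ 1) => ENNReal.ofReal (H.q i (S.1 x))) x hx)

theorem opSeminorm_neg (i : ι) (T : H.L) : opSeminorm i (-T) = opSeminorm i T := by
  refine iSup_congr fun x => iSup_congr fun _ => ?_
  change ENNReal.ofReal (H.q i (-(T.1 x))) = _
  rw [map_neg_eq_map]

theorem opSeminorm_zero (i : ι) : opSeminorm i (0 : H.L) = 0 := by
  refine le_antisymm (iSup₂_le fun x _ => ?_) bot_le
  change ENNReal.ofReal (H.q i 0) ≤ 0
  simp

variable (H) in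
/-- The distance `opSeminorm i (T - S)` on `L_A(X)`. -/
abbrev opDist (i : ι) : PseudoEMetricSpace H.L where
  edist T S := opSeminorm i (T - S)
  edist_self T := by rw [sub_self, opSeminorm_zero]
  edist_comm T S := by rw [← opSeminorm_neg, neg_sub]
  edist_triangle T S R := by
    have := opSeminorm_add_le i (T - S) (S - R)
    rwa [sub_add_sub_cancel] at this

/-- The topology of `L_A(X)`, given by the operator seminorms. -/
instance topologicalSpaceL : TopologicalSpace H.L :=
  ⨅ i, (H.opDist i).toUniformSpace.toTopologicalSpace

theorem continuousL {f : H.L → H.L}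
    (h : ∀ i, ∃ C : ℝ≥0, ∀ T S, opSeminorm i (f T - f S) ≤ C * opSeminorm i (T - S)) :
    Continuous f := by
  refine continuous_iInf_rng.2 fun i => continuous_iInf_dom (i := i) ?_
  obtain ⟨C, hC⟩ := h i
  let _ := H.opDist i
  exact LipschitzWith.continuous (K := C) fun T S => hC T S

/-! ### Compact operators -/

/-- The rank one operator `z ↦ y ⟪x, z⟫`. -/
def theta (y x : H.X) : H.L :=
  ⟨H.rsmul y ∘ₗ
    { toFun := H.inner x
      map_add' := H.inner_add_right x
      map_smul' := fun c z => H.inner_smul_right c x z },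
   H.rsmul x ∘ₗ
    { toFun := H.inner y
      map_add' := H.inner_add_right y
      map_smul' := fun c z => H.inner_smul_right c y z },
   fun z z' => by
    simp [inner_rsmul_left, H.inner_rsmul_right, H.star_inner]⟩

theorem theta_apply (y x z : H.X) : (theta y x : H.L).1 z = H.rsmul y (H.inner x z) := rfl

theorem star_theta (y x : H.X) : star (theta y x : H.L) = theta x y := by
  refine extL fun z z' => ?_
  rw [← inner_star, theta_apply, theta_apply, inner_rsmul_left, H.inner_rsmul_right, H.star_inner]

theorem theta_mul_theta (y x u v : H.X) :
    (theta y x * theta u v : H.L) = theta (H.rsmul y (H.inner x u)) v := by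
  refine Subtype.ext (LinearMap.ext fun z => ?_)
  change H.rsmul y (H.inner x (H.rsmul u (H.inner v z))) = _
  rw [theta_apply, H.inner_rsmul_right, H.rsmul_mul]

variable (H) in
/-- The linear span `Θ(X)` of the rank one operators. -/
def finiteRank : Submodule ℂ H.L := Submodule.span ℂ {T | ∃ y x, T = theta y x}

theorem theta_mem (y x : H.X) : theta y x ∈ H.finiteRank := Submodule.subset_span ⟨y, x, rfl⟩

theorem finiteRank_star {T : H.L} (hT : T ∈ H.finiteRank) : star T ∈ H.finiteRank := by
  induction hT using Submodule.span_induction with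
  | mem T h => obtain ⟨y, x, rfl⟩ := h; rw [star_theta]; exact theta_mem _ _
  | zero => rw [star_zero]; exact zero_mem _
  | add T S _ _ hT hS => rw [star_add]; exact add_mem hT hS
  | smul c T _ hT => rw [star_smul]; exact Submodule.smul_mem _ _ hT

theorem finiteRank_mul {T S : H.L} (hT : T ∈ H.finiteRank) (hS : S ∈ H.finiteRank) :
    T * S ∈ H.finiteRank := by
  induction hT using Submodule.span_induction with
  | mem T h =>
    obtain ⟨y, x, rfl⟩ := h
    induction hS using Submodule.span_induction with
    | mem S h => obtain ⟨u, v, rfl⟩ := h; rw [theta_mul_theta]; exact theta_mem _ _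
    | zero => rw [mul_zero]; exact zero_mem _
    | add T S _ _ hT hS => rw [mul_add]; exact add_mem hT hS
    | smul c T _ hT => rw [mul_smul_comm]; exact Submodule.smul_mem _ _ hT
  | zero => rw [zero_mul]; exact zero_mem _
  | add T S _ _ hT hS => rw [add_mul]; exact add_mem hT hS
  | smul c T _ hT => rw [smul_mul_assoc]; exact Submodule.smul_mem _ _ hT

theorem opSeminorm_smul_le (i : ι) (c : ℂ) (T : H.L) :
    opSeminorm i (c • T) ≤ (‖c‖₊ : ℝ≥0∞) * opSeminorm i T := by
  refine iSup₂_le fun x hx => ?_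
  change ENNReal.ofReal (H.q i (c • T.1 x)) ≤ _
  rw [map_smul_eq_mul, ENNReal.ofReal_mul (norm_nonneg c), ofReal_norm]
  exact mul_le_mul_right
    (le_iSup₂ (f := fun (x : H.X) (_ : H.q i x ≤ 1) => ENNReal.ofReal (H.q i (T.1 x))) x hx) _

theorem opSeminorm_star_le (i : ι) (T : H.L) :
    opSeminorm i (star T) ≤ (3 : ℝ≥0) * opSeminorm i T := by
  by_cases hT : opSeminorm i T = ∞
  · rw [hT, ENNReal.mul_top (by simp)]; exact le_top
  have h : ∀ x, H.q i ((star T).1 x) ≤ 3 * (opSeminorm i T).toReal * H.q i x := by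
    intro x
    have h1 : H.q i ((star T).1 x) ^ 2 ≤
        3 * (opSeminorm i T).toReal * H.q i x * H.q i ((star T).1 x) := by
      rw [q_sq, inner_star']
      refine (p_inner_le i _ _).trans ?_
      have := q_apply_le i T hT ((star T).1 x)
      have h0 : 0 ≤ H.q i x := apply_nonneg _ _
      nlinarith [mul_le_mul_of_nonneg_left this h0]
    rcases (apply_nonneg (H.q i) ((star T).1 x)).eq_or_lt with h | h
    · rw [← h]; exact mul_nonneg (by positivity) (apply_nonneg _ _)
    · rw [pow_two] at h1
      exact le_of_mul_le_mul_right h1 h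
  refine (opSeminorm_le i (star T) (by positivity) h).trans ?_
  rw [ENNReal.ofReal_mul (by norm_num), ENNReal.ofReal_toReal hT]
  simp

theorem opSeminorm_mul_le (i : ι) (T S : H.L) (hT : opSeminorm i T ≠ ∞) :
    opSeminorm i (T * S) ≤ opSeminorm i T * opSeminorm i S := by
  refine iSup₂_le fun x hx => ?_
  change ENNReal.ofReal (H.q i (T.1 (S.1 x))) ≤ _
  calc ENNReal.ofReal (H.q i (T.1 (S.1 x)))
      ≤ ENNReal.ofReal ((opSeminorm i T).toReal * H.q i (S.1 x)) :=
        ENNReal.ofReal_le_ofReal (q_apply_le i T hT _)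
    _ = opSeminorm i T * ENNReal.ofReal (H.q i (S.1 x)) := by
        rw [ENNReal.ofReal_mul ENNReal.toReal_nonneg, ENNReal.ofReal_toReal hT]
    _ ≤ _ := mul_le_mul_right
      (le_iSup₂ (f := fun (x : H.X) (_ : H.q i x ≤ 1) => ENNReal.ofReal (H.q i (S.1 x))) x hx) _

theorem opSeminorm_mul_le' (i : ι) (T S : H.L) (hS : opSeminorm i S ≠ ∞) :
    opSeminorm i (T * S) ≤ opSeminorm i S * opSeminorm i T := by
  by_cases hT : opSeminorm i T = ∞
  · by_cases h0 : opSeminorm i S = 0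
    · refine le_of_eq_of_le ?_ bot_le
      refine le_antisymm (iSup₂_le fun x _ => ?_) bot_le
      have h1 := q_apply_le i S hS x
      rw [h0, ENNReal.toReal_zero, zero_mul] at h1
      have h2 := q_apply_eq_zero i T (le_antisymm h1 (apply_nonneg _ _))
      change ENNReal.ofReal (H.q i (T.1 (S.1 x))) ≤ 0
      rw [h2, ENNReal.ofReal_zero]
    · rw [hT, ENNReal.mul_top h0]; exact le_top
  · rw [mul_comm]; exact opSeminorm_mul_le i T S hT

theorem opSeminorm_ne_top_of_finiteRank (i : ι) {T : H.L} (hT : T ∈ H.finiteRank) :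
    opSeminorm i T ≠ ∞ := by
  induction hT using Submodule.span_induction with
  | mem T h =>
    obtain ⟨y, x, rfl⟩ := h
    refine ne_top_of_le_ne_top ENNReal.ofReal_ne_top
      (opSeminorm_le i _ (C := 3 * H.q i y * H.q i x)
        (mul_nonneg (mul_nonneg (by norm_num) (apply_nonneg _ _)) (apply_nonneg _ _))
        fun z => ?_)
    rw [theta_apply]
    refine (q_rsmul_le i _ _).trans ?_
    have := mul_le_mul_of_nonneg_left (p_inner_le i x z) (apply_nonneg (H.q i) y)
    linarith
  | zero => rw [opSeminorm_zero]; exact ENNReal.zero_ne_top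
  | add T S _ _ hT hS =>
    exact ne_top_of_le_ne_top (ENNReal.add_ne_top.2 ⟨hT, hS⟩) (opSeminorm_add_le i T S)
  | smul c T _ hT =>
    exact ne_top_of_le_ne_top (ENNReal.mul_ne_top ENNReal.coe_ne_top hT) (opSeminorm_smul_le i c T)

theorem opSeminorm_ne_top_of_closure (i : ι) {T : H.L}
    (hT : T ∈ closure (H.finiteRank : Set H.L)) : opSeminorm i T ≠ ∞ := by
  have h1 : T ∈ @closure H.L (H.opDist i).toUniformSpace.toTopologicalSpace
      (H.finiteRank : Set H.L) := closure.mono (iInf_le _ i) hT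
  let _ := H.opDist i
  obtain ⟨S, hS, hd⟩ := EMetric.mem_closure_iff.1 h1 1 one_pos
  have h2 : opSeminorm i (T - S) < 1 := hd
  have h3 := opSeminorm_add_le i (T - S) S
  rw [sub_add_cancel] at h3
  exact ne_top_of_le_ne_top
    (ENNReal.add_ne_top.2 ⟨h2.ne_top, opSeminorm_ne_top_of_finiteRank i hS⟩) h3

variable (H) in
/-- The algebra `K_A(X)` of compact operators, the closure of `Θ(X)` in `L_A(X)`. -/
def K : NonUnitalStarSubalgebra ℂ H.L where
  carrier := closure (H.finiteRank : Set H.L)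
  zero_mem' := subset_closure (zero_mem _)
  add_mem' := by
    have c : ∀ S : H.L, Continuous fun T : H.L => T + S := fun S =>
      continuousL fun i => ⟨1, fun T T' => by simp⟩
    have c' : ∀ S : H.L, Continuous fun T : H.L => S + T := fun S =>
      continuousL fun i => ⟨1, fun T T' => by simp⟩
    have s1 : ∀ S ∈ H.finiteRank, ∀ T ∈ closure (H.finiteRank : Set H.L),
        S + T ∈ closure (H.finiteRank : Set H.L) := fun S hS T hT =>
      map_mem_closure (c' S) hT fun T' hT' => add_mem hS hT'
    intro T S hT hS
    have := map_mem_closure (c S) hT fun T' hT' => s1 T' hT' S hS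
    rwa [closure_closure] at this
  smul_mem' := by
    intro c T hT
    refine map_mem_closure (f := fun T : H.L => c • T) (continuousL fun i => ⟨‖c‖₊, fun T T' => ?_⟩) hT
      fun T' hT' => H.finiteRank.smul_mem c hT'
    rw [← smul_sub]
    exact opSeminorm_smul_le i c _
  mul_mem' := by
    have s1 : ∀ S ∈ H.finiteRank, ∀ T ∈ closure (H.finiteRank : Set H.L),
        S * T ∈ closure (H.finiteRank : Set H.L) := fun S hS T hT => by
      refine map_mem_closure (f := fun T : H.L => S * T) (continuousL fun i =>
        ⟨(opSeminorm i S).toNNReal, fun T T' => ?_⟩) hT fun T' hT' => finiteRank_mul hS hT'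
      have hb := opSeminorm_ne_top_of_finiteRank i hS
      rw [← mul_sub, ENNReal.coe_toNNReal hb]
      exact opSeminorm_mul_le i S _ hb
    intro S T hS hT
    have : S * T ∈ closure (closure (H.finiteRank : Set H.L)) := by
      refine map_mem_closure (f := fun S : H.L => S * T) (continuousL fun i =>
        ⟨(opSeminorm i T).toNNReal, fun S S' => ?_⟩) hS fun S' hS' => s1 S' hS' T hT
      have hb := opSeminorm_ne_top_of_closure i hT
      rw [← sub_mul, ENNReal.coe_toNNReal hb]
      exact opSeminorm_mul_le' i _ T hb
    rwa [closure_closure] at this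
  star_mem' := by
    intro T hT
    refine map_mem_closure (f := fun T : H.L => star T) (continuousL fun i => ⟨3, fun T T' => ?_⟩) hT
      fun T' hT' => finiteRank_star hT'
    have e : star T - star T' = star (T - T') := (star_sub T T').symm
    exact e ▸ opSeminorm_star_le i _

theorem theta_mem_K (y x : H.X) : theta y x ∈ H.K := subset_closure (theta_mem y x)

variable (H)

/-! ### The quotients `A_i` and `X_i` -/

/-- `ker (p i)` -/
def kerA (i : ι) : Submodule ℂ H.A where
  carrier := {a | H.p i a = 0}
  zero_mem' := map_zero _
  add_mem' {a b} ha hb := le_antisymm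
    ((map_add_le_add (H.p i) a b).trans (by rw [ha, hb, add_zero])) (apply_nonneg _ _)
  smul_mem' c a ha := by
    change H.p i (c • a) = 0
    rw [map_smul_eq_mul, ha, mul_zero]

/-- `ker (q i)` -/
def kerX (i : ι) : Submodule ℂ H.X where
  carrier := {x | H.q i x = 0}
  zero_mem' := map_zero _
  add_mem' {a b} ha hb := le_antisymm
    ((map_add_le_add (H.q i) a b).trans (by rw [ha, hb, add_zero])) (apply_nonneg _ _)
  smul_mem' c a ha := by
    change H.q i (c • a) = 0
    rw [map_smul_eq_mul, ha, mul_zero]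

variable {H}

theorem mem_kerA {i : ι} {a : H.A} : a ∈ H.kerA i ↔ H.p i a = 0 := Iff.rfl

theorem mem_kerX {i : ι} {x : H.X} : x ∈ H.kerX i ↔ H.q i x = 0 := Iff.rfl

theorem mul_mem_kerA_left {i : ι} (a : H.A) {b : H.A} (hb : b ∈ H.kerA i) :
    a * b ∈ H.kerA i :=
  mem_kerA.2 <| le_antisymm
    ((H.p_mul_le i a b).trans (by rw [mem_kerA.1 hb, mul_zero])) (apply_nonneg _ _)

theorem mul_mem_kerA_right {i : ι} {a : H.A} (b : H.A) (ha : a ∈ H.kerA i) :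
    a * b ∈ H.kerA i :=
  mem_kerA.2 <| le_antisymm
    ((H.p_mul_le i a b).trans (by rw [mem_kerA.1 ha, zero_mul])) (apply_nonneg _ _)

theorem star_mem_kerA {i : ι} {a : H.A} (ha : a ∈ H.kerA i) : star a ∈ H.kerA i := by
  rw [mem_kerA, p_star]; exact ha

theorem seminorm_sub_eq {E : Type*} [AddCommGroup E] [Module ℂ E] (r : Seminorm ℂ E) {x y : E}
    (h : r (x - y) = 0) : r x = r y := by
  have h1 := abs_sub_map_le_sub r x y
  rw [h] at h1
  exact sub_eq_zero.1 (abs_eq_zero.1 (le_antisymm h1 (abs_nonneg _)))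

variable (H)

/-- The quotient algebra `A_i = A / ker (p i)`. -/
def LevelA (i : ι) : Type u := H.A ⧸ H.kerA i

/-- The quotient module `X_i = X / ker (q i)`. -/
def LevelX (i : ι) : Type v := H.X ⧸ H.kerX i

instance (i : ι) : AddCommGroup (H.LevelA i) := inferInstanceAs (AddCommGroup (H.A ⧸ H.kerA i))

instance (i : ι) : Module ℂ (H.LevelA i) := inferInstanceAs (Module ℂ (H.A ⧸ H.kerA i))

instance (i : ι) : AddCommGroup (H.LevelX i) := inferInstanceAs (AddCommGroup (H.X ⧸ H.kerX i))

instance (i : ι) : Module ℂ (H.LevelX i) := inferInstanceAs (Module ℂ (H.X ⧸ H.kerX i))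

/-- The quotient map `A → A_i` as a linear map. -/
def mkA (i : ι) : H.A →ₗ[ℂ] H.LevelA i := (H.kerA i).mkQ

/-- The quotient map `X → X_i` as a linear map. -/
def mkX (i : ι) : H.X →ₗ[ℂ] H.LevelX i := (H.kerX i).mkQ

variable {H}

theorem mkA_surjective (i : ι) : Function.Surjective (H.mkA i) := (H.kerA i).mkQ_surjective

theorem mkX_surjective (i : ι) : Function.Surjective (H.mkX i) := (H.kerX i).mkQ_surjective

theorem mkA_eq {i : ι} {a b : H.A} : H.mkA i a = H.mkA i b ↔ H.p i (a - b) = 0 :=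
  Submodule.Quotient.eq _

theorem mkX_eq {i : ι} {x y : H.X} : H.mkX i x = H.mkX i y ↔ H.q i (x - y) = 0 :=
  Submodule.Quotient.eq _

theorem mkA_eq_zero {i : ι} {a : H.A} : H.mkA i a = 0 ↔ H.p i a = 0 :=
  Submodule.Quotient.mk_eq_zero _

theorem mkX_eq_zero {i : ι} {x : H.X} : H.mkX i x = 0 ↔ H.q i x = 0 :=
  Submodule.Quotient.mk_eq_zero _

theorem mul_sub_mul_mem_kerA {i : ι} {a a' b b' : H.A} (h : a - a' ∈ H.kerA i)
    (h' : b - b' ∈ H.kerA i) : a * b - a' * b' ∈ H.kerA i := by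
  have e : a * b - a' * b' = (a - a') * b + a' * (b - b') := by
    rw [sub_mul, mul_sub]; abel
  rw [e]
  exact add_mem (mul_mem_kerA_right _ h) (mul_mem_kerA_left _ h')

theorem inner_sub_inner_mem_kerA {i : ι} {x x' y y' : H.X} (h : x - x' ∈ H.kerX i)
    (h' : y - y' ∈ H.kerX i) : H.inner x y - H.inner x' y' ∈ H.kerA i := by
  have e : H.inner x y - H.inner x' y' = H.inner (x - x') y + H.inner x' (y - y') := by
    rw [inner_sub_left, inner_sub_right]; abel
  rw [e]
  exact add_mem (p_inner_eq_zero i (Or.inl h)) (p_inner_eq_zero i (Or.inr h'))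

instance (i : ι) : Mul (H.LevelA i) where
  mul := Quotient.map₂ (· * ·) fun _ _ h _ _ h' => (Submodule.quotientRel_def _).2
    (mul_sub_mul_mem_kerA ((Submodule.quotientRel_def _).1 h) ((Submodule.quotientRel_def _).1 h'))

instance (i : ι) : Star (H.LevelA i) where
  star := Quotient.map star fun a b h => (Submodule.quotientRel_def _).2 (by
    rw [← star_sub]
    exact star_mem_kerA ((Submodule.quotientRel_def _).1 h))

theorem mkA_mul (i : ι) (a b : H.A) : H.mkA i (a * b) = H.mkA i a * H.mkA i b := rfl

theorem mkA_star (i : ι) (a : H.A) : H.mkA i (star a) = star (H.mkA i a) := rfl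

instance (i : ι) : NonUnitalRing (H.LevelA i) where
  left_distrib := (mkA_surjective i).forall₃.2 fun a b c => by
    simp only [← mkA_mul, ← map_add, mul_add]
  right_distrib := (mkA_surjective i).forall₃.2 fun a b c => by
    simp only [← mkA_mul, ← map_add, add_mul]
  zero_mul := (mkA_surjective i).forall.2 fun a => by
    rw [← map_zero (H.mkA i), ← mkA_mul, zero_mul]
  mul_zero := (mkA_surjective i).forall.2 fun a => by
    rw [← map_zero (H.mkA i), ← mkA_mul, mul_zero]
  mul_assoc := (mkA_surjective i).forall₃.2 fun a b c => by
    simp only [← mkA_mul, mul_assoc]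

instance (i : ι) : StarRing (H.LevelA i) where
  star_involutive := (mkA_surjective i).forall.2 fun a => by
    simp only [← mkA_star, star_star]
  star_mul := (mkA_surjective i).forall₂.2 fun a b => by
    simp only [← mkA_star, ← mkA_mul, star_mul]
  star_add := (mkA_surjective i).forall₂.2 fun a b => by
    simp only [← mkA_star, ← map_add, star_add]

instance (i : ι) : IsScalarTower ℂ (H.LevelA i) (H.LevelA i) where
  smul_assoc c := (mkA_surjective i).forall₂.2 fun a b => by
    simp only [smul_eq_mul, ← mkA_mul, ← map_smul, smul_mul_assoc]

instance (i : ι) : SMulCommClass ℂ (H.LevelA i) (H.LevelA i) where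
  smul_comm c := (mkA_surjective i).forall₂.2 fun a b => by
    simp only [smul_eq_mul, ← mkA_mul, ← map_smul, mul_smul_comm]

instance (i : ι) : StarModule ℂ (H.LevelA i) where
  star_smul c := (mkA_surjective i).forall.2 fun a => by
    simp only [← mkA_star, ← map_smul, star_smul]

variable (H)

/-- The norm of `A_i`, `‖a + ker (p i)‖ = p i a`. -/
def levelP (i : ι) : Seminorm ℂ (H.LevelA i) :=
  Seminorm.of (Quotient.lift (H.p i) fun _ _ h =>
      seminorm_sub_eq _ ((Submodule.quotientRel_def _).1 h))
    ((mkA_surjective i).forall₂.2 fun a b => map_add_le_add (H.p i) a b)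
    (fun c => (mkA_surjective i).forall.2 fun a => map_smul_eq_mul (H.p i) c a)

/-- The norm of `X_i`, `‖x + ker (q i)‖ = q i x`. -/
def levelQ (i : ι) : Seminorm ℂ (H.LevelX i) :=
  Seminorm.of (Quotient.lift (H.q i) fun _ _ h =>
      seminorm_sub_eq _ ((Submodule.quotientRel_def _).1 h))
    ((mkX_surjective i).forall₂.2 fun a b => map_add_le_add (H.q i) a b)
    (fun c => (mkX_surjective i).forall.2 fun a => map_smul_eq_mul (H.q i) c a)

variable {H} in
theorem levelP_mkA (i : ι) (a : H.A) : H.levelP i (H.mkA i a) = H.p i a := rfl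

variable {H} in
theorem levelQ_mkX (i : ι) (x : H.X) : H.levelQ i (H.mkX i x) = H.q i x := rfl

/-- The inner product of `X_i`, `⟪x + ker, y + ker⟫ = ⟪x, y⟫ + ker`. -/
def levelInner (i : ι) : H.LevelX i → H.LevelX i → H.LevelA i :=
  Quotient.map₂ H.inner fun _ _ h _ _ h' => (Submodule.quotientRel_def _).2
    (inner_sub_inner_mem_kerA ((Submodule.quotientRel_def _).1 h)
      ((Submodule.quotientRel_def _).1 h'))

variable {H} in
theorem levelInner_mk (i : ι) (x y : H.X) :
    H.levelInner i (H.mkX i x) (H.mkX i y) = H.mkA i (H.inner x y) := rfl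

/-- The right action of `A_i` on `X_i`, `(x + ker) (a + ker) = x a + ker`. -/
def levelRsmul (i : ι) : H.LevelX i →ₗ[ℂ] H.LevelA i →ₗ[ℂ] H.LevelX i :=
  (H.kerX i).liftQ
    { toFun := fun x => (H.kerA i).liftQ (H.mkX i ∘ₗ H.rsmul x) fun a ha => by
        refine LinearMap.mem_ker.2 (mkX_eq_zero.2 (le_antisymm ?_ (apply_nonneg _ _)))
        exact (q_rsmul_le i x a).trans (by rw [mem_kerA.1 ha, mul_zero])
      map_add' := fun x y => LinearMap.ext <| (mkA_surjective i).forall.2 fun a => by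
        change H.mkX i (H.rsmul (x + y) a) = H.mkX i (H.rsmul x a) + H.mkX i (H.rsmul y a)
        rw [map_add, LinearMap.add_apply, map_add]
      map_smul' := fun c x => LinearMap.ext <| (mkA_surjective i).forall.2 fun a => by
        change H.mkX i (H.rsmul (c • x) a) = c • H.mkX i (H.rsmul x a)
        rw [map_smul, LinearMap.smul_apply, map_smul] }
    fun x hx => LinearMap.mem_ker.2 <| LinearMap.ext <| (mkA_surjective i).forall.2 fun a => by
        refine mkX_eq_zero.2 (le_antisymm ?_ (apply_nonneg _ _))
        exact (q_rsmul_le i x a).trans (by rw [mem_kerX.1 hx, zero_mul])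

variable {H} in
theorem levelRsmul_mk (i : ι) (x : H.X) (a : H.A) :
    H.levelRsmul i (H.mkX i x) (H.mkA i a) = H.mkX i (H.rsmul x a) := rfl

/-- The `C*`-algebra `A_i` and the Hilbert `A_i`-module `X_i`. -/
def level (i : ι) : PreHilbertPair.{0, u, v} PUnit where
  A := H.LevelA i
  X := H.LevelX i
  p := fun _ => H.levelP i
  p_mul_le := fun _ => (mkA_surjective i).forall₂.2 fun a b => H.p_mul_le i a b
  p_star_mul_self := fun _ => (mkA_surjective i).forall.2 fun a => H.p_star_mul_self i a
  p_separating := (mkA_surjective i).forall.2 fun a h => mkA_eq_zero.2 (h PUnit.unit)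
  rsmul := H.levelRsmul i
  rsmul_mul := (mkX_surjective i).forall.2 fun x => (mkA_surjective i).forall₂.2 fun a b => by
    simp only [← mkA_mul, levelRsmul_mk, H.rsmul_mul]
  inner := H.levelInner i
  inner_add_right := (mkX_surjective i).forall₃.2 fun x y z => by
    simp only [levelInner_mk, ← map_add, H.inner_add_right]
  inner_smul_right := fun c => (mkX_surjective i).forall₂.2 fun x y => by
    simp only [levelInner_mk, ← map_smul, H.inner_smul_right]
  inner_rsmul_right := (mkX_surjective i).forall₂.2 fun x y => (mkA_surjective i).forall.2
    fun a => by simp only [levelInner_mk, levelRsmul_mk, H.inner_rsmul_right, mkA_mul]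
  star_inner := (mkX_surjective i).forall₂.2 fun x y => by
    simp only [levelInner_mk, ← mkA_star, H.star_inner]
  inner_self_nonneg := (mkX_surjective i).forall.2 fun x => by
    obtain ⟨b, hb⟩ := H.inner_self_nonneg x
    exact ⟨H.mkA i b, by simp only [levelInner_mk, ← mkA_star, ← mkA_mul, hb]⟩
  inner_self_eq_zero := (mkX_surjective i).forall.2 fun x h => by
    rw [levelInner_mk, mkA_eq_zero, ← q_sq] at h
    exact mkX_eq_zero.2 (pow_eq_zero_iff two_ne_zero |>.1 h)
  q := fun _ => H.levelQ i
  q_eq := fun _ => (mkX_surjective i).forall.2 fun x => H.q_eq i x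

/-- The canonical map `π_i : A → A_i`. -/
def piA (i : ι) : H.A →⋆ₙₐ[ℂ] (H.level i).A where
  toFun := H.mkA i
  map_smul' := map_smul (H.mkA i)
  map_zero' := map_zero (H.mkA i)
  map_add' := map_add (H.mkA i)
  map_mul' := mkA_mul i
  map_star' := mkA_star i

/-- The canonical map `σ_i : X → X_i`. -/
def sigmaX (i : ι) : H.X →ₗ[ℂ] (H.level i).X := H.mkX i

variable {H}

theorem piA_surjective (i : ι) : Function.Surjective (H.piA i) := mkA_surjective i

theorem sigmaX_surjective (i : ι) : Function.Surjective (H.sigmaX i) := mkX_surjective i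

theorem piA_eq_zero {i : ι} {a : H.A} : H.piA i a = 0 ↔ H.p i a = 0 := mkA_eq_zero

theorem sigmaX_eq_zero {i : ι} {x : H.X} : H.sigmaX i x = 0 ↔ H.q i x = 0 := mkX_eq_zero

theorem inner_sigmaX (i : ι) (x y : H.X) :
    (H.level i).inner (H.sigmaX i x) (H.sigmaX i y) = H.piA i (H.inner x y) := rfl

variable (H)

/-- The operator induced on `X_i` by an adjointable operator on `X`. -/
def levelEnd (i : ι) (T : H.L) : Module.End ℂ (H.level i).X :=
  (H.kerX i).liftQ (H.mkX i ∘ₗ T.1) fun _ hx =>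
    LinearMap.mem_ker.2 (mkX_eq_zero.2 (q_apply_eq_zero i T hx))

variable {H} in
theorem levelEnd_sigmaX (i : ι) (T : H.L) (x : H.X) :
    H.levelEnd i T (H.sigmaX i x) = H.sigmaX i (T.1 x) := rfl

/-- The operator induced on `X_i` is adjointable. -/
def levelOp (i : ι) (T : H.L) : (H.level i).L :=
  ⟨H.levelEnd i T, H.levelEnd i (star T), (sigmaX_surjective i).forall₂.2 fun x y => by
    simp only [levelEnd_sigmaX, inner_sigmaX, inner_star]⟩

variable {H} in
theorem levelOp_sigmaX (i : ι) (T : H.L) (x : H.X) :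
    (H.levelOp i T).1 (H.sigmaX i x) = H.sigmaX i (T.1 x) := rfl

variable {H} in
theorem ext_level {i : ι} {T S : (H.level i).L}
    (h : ∀ x, T.1 (H.sigmaX i x) = S.1 (H.sigmaX i x)) : T = S :=
  Subtype.ext (LinearMap.ext ((sigmaX_surjective i).forall.2 h))

/-- The canonical map `L_A(X) → L_{A_i}(X_i)`, `π_i(T) (σ_i x) = σ_i (T x)`. -/
def piL (i : ι) : H.L →⋆ₙₐ[ℂ] (H.level i).L where
  toFun := H.levelOp i
  map_smul' c T := ext_level fun x => map_smul (H.sigmaX i) c (T.1 x)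
  map_zero' := ext_level fun _ => map_zero (H.sigmaX i)
  map_add' T S := ext_level fun x => map_add (H.sigmaX i) (T.1 x) (S.1 x)
  map_mul' _ _ := ext_level fun _ => rfl
  map_star' T := extL <| (sigmaX_surjective i).forall₂.2 fun x y => by
    rw [← inner_star]
    simp only [levelOp_sigmaX, inner_sigmaX, inner_star]

end PreHilbertPair

/-! ### Correspondences -/

/-- A `PreHilbertPair` with a left action `φ : A → L_A(X)` by a `*`-homomorphism. -/
structure PreCorrespondence (ι : Type w) where
  /-- the algebra and the module -/
  H : PreHilbertPair.{w, u, v} ι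
  /-- the left action -/
  φ : H.A →⋆ₙₐ[ℂ] H.L

/-- A pro-`C*`-correspondence `(X, A, φ)`: `A` is a pro-`C*`-algebra, whose topology is given by the
upward directed family of `C*`-seminorms `p`, `X` is a (complete) Hilbert pro-`C*`-module over `A`,
and `φ : A → L_A(X)` is a continuous `*`-homomorphism. -/
structure ProCStarCorrespondence (Λ : Type w) [Preorder Λ] [IsDirectedOrder Λ] [Nonempty Λ]
    extends PreCorrespondence.{w, u, v} Λ where
  p_mono : Monotone H.p
  completeSpace_A : CompleteSpace H.A
  completeSpace_X : CompleteSpace H.X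
  continuous_φ : Continuous φ

namespace PreCorrespondence

open PreHilbertPair

variable {ι : Type w}

/-- A `C*`-correspondence: `A` is a `C*`-algebra, `X` is a Hilbert `C*`-module over `A`, and `φ` is
a continuous `*`-homomorphism. -/
structure IsCStarCorrespondence (C : PreCorrespondence.{0, u, v} PUnit) : Prop where
  completeSpace_A : CompleteSpace C.H.A
  completeSpace_X : CompleteSpace C.H.X
  continuous_φ : Continuous C.φ

variable (E : PreCorrespondence.{w, u, v} ι)

/-- `X(I)`, the closed linear span of `⟪y, φ(a) x⟫`, `a ∈ I`, `x, y ∈ X`. -/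
def idealImage (I : Set E.H.A) : Set E.H.A :=
  closure (Submodule.span ℂ {b | ∃ a ∈ I, ∃ x y, b = E.H.inner y ((E.φ a).1 x)} : Set E.H.A)

/-- `X⁻¹(I)` -/
def idealPreimage (I : Set E.H.A) : Set E.H.A :=
  {a | ∀ x y, E.H.inner y ((E.φ a).1 x) ∈ I}

/-- `J_X^i`: the `a` for which `φ(a)` induces a compact operator on `X_i`, and which are modulo
`ker (p i)` orthogonal to the kernel of the action of `A` on `X_i`. -/
def levelIdeal (i : ι) : Set E.H.A :=
  {a | E.H.piL i (E.φ a) ∈ (E.H.level i).K ∧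
    ∀ b, E.H.piL i (E.φ b) = 0 → E.H.piA i (a * b) = 0}

/-- `𝒥_X`, the intersection of all `J_X^i`. -/
def covarianceIdeal : Set E.H.A := ⋂ i, E.levelIdeal i

/-- Katsura's ideal `φ⁻¹(K(X)) ∩ (ker φ)^⊥`. -/
def katsuraIdeal : Set E.H.A :=
  {a | E.φ a ∈ E.H.K ∧ ∀ b, E.φ b = 0 → a * b = 0}

/-- `X(I) ⊆ I` -/
def PositivelyInvariant (I : Set E.H.A) : Prop := E.idealImage I ⊆ I

/-- `π_μ(J_X^λ) ∩ π_μ(X⁻¹(I)) ⊆ π_μ(I)` for all `μ ≤ λ` -/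
def NegativelyInvariant [Preorder ι] (I : Set E.H.A) : Prop :=
  ∀ ⦃m l : ι⦄, m ≤ l →
    E.H.piA m '' E.levelIdeal l ∩ E.H.piA m '' E.idealPreimage I ⊆ E.H.piA m '' I

/-- positive and negative invariance of an ideal -/
def Invariant [Preorder ι] (I : Set E.H.A) : Prop :=
  E.PositivelyInvariant I ∧ E.NegativelyInvariant I

variable {E} in
theorem piL_φ_eq_zero {i : ι} (h : E.PositivelyInvariant (E.H.kerA i)) {a : E.H.A}
    (ha : E.H.piA i a = 0) : E.H.piL i (E.φ a) = 0 := by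
  refine ext_level fun x => ?_
  change E.H.sigmaX i ((E.φ a).1 x) = 0
  rw [sigmaX_eq_zero, ← pow_eq_zero_iff two_ne_zero, q_sq]
  exact h (subset_closure (Submodule.subset_span ⟨a, piA_eq_zero.1 ha, x, _, rfl⟩))

/-- The underlying function of the induced action `A_i → L_{A_i}(X_i)`. -/
def levelFun (i : ι) (a : (E.H.level i).A) : (E.H.level i).L :=
  E.H.piL i (E.φ (Function.surjInv (E.H.piA_surjective i) a))

variable {E} in
theorem levelFun_piA {i : ι} (h : E.PositivelyInvariant (E.H.kerA i)) (a : E.H.A) :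
    E.levelFun i (E.H.piA i a) = E.H.piL i (E.φ a) := by
  rw [levelFun, ← sub_eq_zero, ← map_sub, ← map_sub]
  refine piL_φ_eq_zero h ?_
  rw [map_sub, Function.surjInv_eq (E.H.piA_surjective i), sub_self]

/-- The `C*`-correspondence `(X_i, A_i, φ_i)`, with `φ_i(π_i a) (σ_i x) = σ_i (φ(a) x)`, for
positively invariant `ker (p i)`. -/
def level (i : ι) (h : E.PositivelyInvariant (E.H.kerA i)) :
    PreCorrespondence.{0, u, v} PUnit where
  H := E.H.level i
  φ :=
    { toFun := E.levelFun i
      map_smul' := fun c => (E.H.piA_surjective i).forall.2 fun a => by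
        rw [← map_smul, levelFun_piA h, levelFun_piA h, map_smul, map_smul]
        rfl
      map_zero' := by rw [← map_zero (E.H.piA i), levelFun_piA h, map_zero, map_zero]
      map_add' := (E.H.piA_surjective i).forall₂.2 fun a b => by
        rw [← map_add]
        simp only [levelFun_piA h]
        rw [map_add, map_add]
      map_mul' := (E.H.piA_surjective i).forall₂.2 fun a b => by
        rw [← map_mul]
        simp only [levelFun_piA h]
        rw [map_mul, map_mul]
      map_star' := (E.H.piA_surjective i).forall.2 fun a => by
        rw [← map_star]
        simp only [levelFun_piA h]
        rw [map_star, map_star] }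

/-- The defining property of `φ_i`. -/
theorem level_φ (i : ι) (h : E.PositivelyInvariant (E.H.kerA i)) (a : E.H.A) (x : E.H.X) :
    ((E.level i h).φ (E.H.piA i a)).1 (E.H.sigmaX i x) = E.H.sigmaX i ((E.φ a).1 x) :=
  congrArg (fun T : (E.H.level i).L => T.1 (E.H.sigmaX i x)) (levelFun_piA h a)

end PreCorrespondence

/-! ### Inverse limits -/

namespace PreHilbertPair

variable {ι : Type w} (H : PreHilbertPair.{w, u, v} ι)

theorem q_le_of_p_le {H : PreHilbertPair.{w, u, v} ι} {m l : ι} (h : H.p m ≤ H.p l) :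
    H.q m ≤ H.q l := fun x => by
  rw [H.q_eq, H.q_eq]
  exact Real.sqrt_le_sqrt (h _)

/-- The canonical map `π_{lm} : A_l → A_m` for `p m ≤ p l`. -/
def piTrans {m l : ι} (h : H.p m ≤ H.p l) : (H.level l).A →⋆ₙₐ[ℂ] (H.level m).A :=
  let f : (H.level l).A →ₗ[ℂ] (H.level m).A := (H.kerA l).liftQ (H.mkA m) fun a ha =>
    LinearMap.mem_ker.2 (mkA_eq_zero.2
      (le_antisymm ((h a).trans (mem_kerA.1 ha).le) (apply_nonneg _ _)))
  { toFun := f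
    map_smul' := map_smul f
    map_zero' := map_zero f
    map_add' := map_add f
    map_mul' := (H.piA_surjective l).forall₂.2 fun a b => mkA_mul m a b
    map_star' := (H.piA_surjective l).forall.2 fun a => mkA_star m a }

/-- The canonical map `σ_{lm} : X_l → X_m` for `p m ≤ p l`. -/
def sigmaTrans {m l : ι} (h : H.p m ≤ H.p l) : (H.level l).X →ₗ[ℂ] (H.level m).X :=
  (H.kerX l).liftQ (H.mkX m) fun x hx =>
    LinearMap.mem_ker.2 (mkX_eq_zero.2
      (le_antisymm ((q_le_of_p_le h x).trans (mem_kerX.1 hx).le) (apply_nonneg _ _)))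

theorem piTrans_piA {m l : ι} (h : H.p m ≤ H.p l) (a : H.A) :
    H.piTrans h (H.piA l a) = H.piA m a := rfl

theorem sigmaTrans_sigmaX {m l : ι} (h : H.p m ≤ H.p l) (x : H.X) :
    H.sigmaTrans h (H.sigmaX l x) = H.sigmaX m x := rfl

end PreHilbertPair

/-- `(C, πt, σt)` is an inverse system of `C*`-correspondences, and `(X, A, φ)` is, through the
maps `π` and `σ`, its inverse limit: `A = lim A_l` as topological `*`-algebras, `X = lim X_l` as
topological vector spaces with the limit module structure and inner product, and `φ = lim φ_l`. -/
structure IsInverseLimit {Λ : Type w} [Preorder Λ] (E : PreCorrespondence.{w, u, v} Λ)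
    (C : Λ → PreCorrespondence.{0, u, v} PUnit)
    (πt : ∀ ⦃m l : Λ⦄, m ≤ l → (C l).H.A →⋆ₙₐ[ℂ] (C m).H.A)
    (σt : ∀ ⦃m l : Λ⦄, m ≤ l → (C l).H.X →ₗ[ℂ] (C m).H.X)
    (π : ∀ l, E.H.A →⋆ₙₐ[ℂ] (C l).H.A) (σ : ∀ l, E.H.X →ₗ[ℂ] (C l).H.X) : Prop where
  isCStarCorrespondence : ∀ l, (C l).IsCStarCorrespondence
  inverseSystem_A : InverseSystem fun _ _ h => πt h
  inverseSystem_X : InverseSystem fun _ _ h => σt h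
  continuous_πt : ∀ m l (h : m ≤ l), Continuous (πt h)
  continuous_σt : ∀ m l (h : m ≤ l), Continuous (σt h)
  inner_σt : ∀ m l (h : m ≤ l) x y,
    (C m).H.inner (σt h x) (σt h y) = πt h ((C l).H.inner x y)
  rsmul_σt : ∀ m l (h : m ≤ l) x a,
    (C m).H.rsmul (σt h x) (πt h a) = σt h ((C l).H.rsmul x a)
  φ_σt : ∀ m l (h : m ≤ l) a x,
    ((C m).φ (πt h a)).1 (σt h x) = σt h (((C l).φ a).1 x)
  inner_σ : ∀ l x y, (C l).H.inner (σ l x) (σ l y) = π l (E.H.inner x y)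
  rsmul_σ : ∀ l x a, (C l).H.rsmul (σ l x) (π l a) = σ l (E.H.rsmul x a)
  φ_σ : ∀ l a x, ((C l).φ (π l a)).1 (σ l x) = σ l ((E.φ a).1 x)
  isEmbedding_A : IsEmbedding fun a l => π l a
  range_A : Set.range (fun a l => π l a) = {f | ∀ m l (h : m ≤ l), πt h (f l) = f m}
  isEmbedding_X : IsEmbedding fun x l => σ l x
  range_X : Set.range (fun x l => σ l x) = {f | ∀ m l (h : m ≤ l), σt h (f l) = f m}

/-- The inverse limit of an inverse system of `C*`-algebras, as a topological `*`-algebra: the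
algebra of coherent families, with the topology of the product. -/
def limitAlgebra {Λ : Type w} [Preorder Λ] {O : Λ → Type u} [∀ l, NonUnitalCStarAlgebra (O l)]
    (ρ : ∀ ⦃m l : Λ⦄, m ≤ l → O l →⋆ₙₐ[ℂ] O m) : NonUnitalStarSubalgebra ℂ (∀ l, O l) where
  carrier := {f | ∀ m l (h : m ≤ l), ρ h (f l) = f m}
  zero_mem' := fun _ _ _ => map_zero _
  add_mem' := fun hf hg m l h => by rw [Pi.add_apply, map_add, hf, hg]; rfl
  mul_mem' := fun hf hg m l h => by rw [Pi.mul_apply, map_mul, hf, hg]; rfl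
  smul_mem' := fun c f hf m l h => by rw [Pi.smul_apply, map_smul, hf]; rfl
  star_mem' := fun hf m l h => by rw [Pi.star_apply, map_star, hf]; rfl

/-! ### Representations -/

theorem PreHilbertPair.topologyA_eq (H : PreHilbertPair.{0, u, v} PUnit) :
    H.uniformSpaceA.toTopologicalSpace =
      (H.p PUnit.unit).toAddGroupSeminorm.toSeminormedAddCommGroup.toUniformSpace.toTopologicalSpace := by
  rw [PreHilbertPair.uniformSpaceA, ciInf_unique]

/-- A representation `(π, t)` of a correspondence on a topological `*`-algebra `B`, i.e. a morphism
to the identity correspondence of `B`. -/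
structure Representation {ι : Type w} (E : PreCorrespondence.{w, u, v} ι) (B : Type*)
    [NonUnitalRing B] [StarRing B] [Module ℂ B] [TopologicalSpace B] where
  /-- the `*`-homomorphism -/
  π : E.H.A →⋆ₙₐ[ℂ] B
  /-- the map on the module -/
  t : E.H.X → B
  continuous_π : Continuous π
  star_t_mul_t : ∀ x y, star (t x) * t y = π (E.H.inner x y)
  π_mul_t : ∀ a x, π a * t x = t ((E.φ a).1 x)

namespace Representation

/-- Covariance of `(π, t)` on a set `J`: for the continuous `*`-homomorphism `ψ : K(X) → B` with
`ψ(θ_{x,y}) = t(x) t(y)*` one has `ψ(φ(a)) = π(a)` for all `a ∈ J`. -/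
def IsCovariantOn {ι : Type w} {E : PreCorrespondence.{w, u, v} ι} {B : Type*}
    [NonUnitalRing B] [StarRing B] [Module ℂ B] [TopologicalSpace B]
    (R : Representation E B) (J : Set E.H.A) : Prop :=
  ∃ ψ : E.H.K →⋆ₙₐ[ℂ] B, Continuous ψ ∧
    (∀ x y, ψ ⟨PreHilbertPair.theta x y, PreHilbertPair.theta_mem_K x y⟩ = R.t x * star (R.t y)) ∧
    ∀ a ∈ J, ∃ h : E.φ a ∈ E.H.K, ψ ⟨E.φ a, h⟩ = R.π a

variable {C : PreCorrespondence.{0, u, v} PUnit} {B : Type*} [NonUnitalCStarAlgebra B]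

theorem exists_bound (R : Representation C B) :
    ∃ M : ℝ, 0 ≤ M ∧ ∀ a, ‖R.π a‖ ≤ M * C.H.p PUnit.unit a := by
  have hc : Continuous R.π := R.continuous_π
  rw [PreHilbertPair.topologyA_eq] at hc
  let _ : SeminormedAddCommGroup C.H.A :=
    (C.H.p PUnit.unit).toAddGroupSeminorm.toSeminormedAddCommGroup
  obtain ⟨δ, hδ, h⟩ := Metric.continuous_iff.1 hc 0 1 one_pos
  have h' : ∀ a, C.H.p PUnit.unit a < δ → ‖R.π a‖ < 1 := fun a ha => by
    have h1 := h a (by rw [dist_zero_right]; exact ha)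
    rwa [map_zero, dist_zero_right] at h1
  refine ⟨2 / δ, by positivity, fun a => ?_⟩
  rcases (apply_nonneg (C.H.p PUnit.unit) a).eq_or_lt with h0 | h0
  · rw [C.H.p_separating a fun _ => h0.symm]
    simp
  · have hr : 0 < δ / (2 * C.H.p PUnit.unit a) := by positivity
    have h2 := h' (((δ / (2 * C.H.p PUnit.unit a) : ℝ) : ℂ) • a) (by
      rw [map_smul_eq_mul, Complex.norm_real, Real.norm_eq_abs, abs_of_pos hr]
      have : δ / (2 * C.H.p PUnit.unit a) * C.H.p PUnit.unit a = δ / 2 := by field_simp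
      rw [this]; linarith)
    rw [map_smul, norm_smul, Complex.norm_real, Real.norm_eq_abs, abs_of_pos hr] at h2
    have h3 : ‖R.π a‖ < 1 / (δ / (2 * C.H.p PUnit.unit a)) := by
      rw [lt_div_iff₀ hr, mul_comm]; exact h2
    refine h3.le.trans (le_of_eq ?_)
    field_simp

theorem norm_π_le (R : Representation C B) (a : C.H.A) : ‖R.π a‖ ≤ C.H.p PUnit.unit a := by
  obtain ⟨M, hM0, hM⟩ := R.exists_bound
  have key : ∀ n : ℕ, ∀ a, ‖R.π a‖ ^ (2 ^ n) ≤ M * C.H.p PUnit.unit a ^ (2 ^ n) := by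
    intro n
    induction n with
    | zero => intro a; simpa using hM a
    | succ n ih =>
      intro a
      have h := ih (star a * a)
      rw [map_mul, map_star, CStarRing.norm_star_mul_self, C.H.p_star_mul_self, ← pow_two,
        ← pow_mul, ← pow_mul, ← pow_succ'] at h
      exact h
  by_contra! hlt
  rcases (apply_nonneg (C.H.p PUnit.unit) a).eq_or_lt with h0 | h0
  · have := hM a
    rw [← h0] at this hlt
    linarith
  · obtain ⟨n, hn⟩ := pow_unbounded_of_one_lt M ((one_lt_div h0).2 hlt)
    have h1 : (‖R.π a‖ / C.H.p PUnit.unit a) ^ n ≤ (‖R.π a‖ / C.H.p PUnit.unit a) ^ (2 ^ n) :=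
      pow_le_pow_right₀ ((one_lt_div h0).2 hlt).le Nat.lt_two_pow_self.le
    have h2 : (‖R.π a‖ / C.H.p PUnit.unit a) ^ (2 ^ n) ≤ M := by
      rw [div_pow, div_le_iff₀ (by positivity)]
      exact key n a
    linarith

theorem norm_t_le (R : Representation C B) (x : C.H.X) : ‖R.t x‖ ≤ C.H.q PUnit.unit x := by
  have h : ‖R.t x‖ ^ 2 ≤ C.H.q PUnit.unit x ^ 2 := by
    rw [pow_two, ← CStarRing.norm_star_mul_self, R.star_t_mul_t, PreHilbertPair.q_sq]
    exact R.norm_π_le _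
  exact le_of_sq_le_sq h (apply_nonneg _ _)

end Representation

/-! ### The `C*`-algebra `O_X` of a `C*`-correspondence -/

namespace PreCorrespondence

variable (C : PreCorrespondence.{0, u, v} PUnit)

/-- A covariant representation of a `C*`-correspondence on some `C*`-algebra. -/
structure CovariantRep where
  /-- the `C*`-algebra -/
  B : Type max u v
  [cstar : NonUnitalCStarAlgebra B]
  /-- the representation -/
  R : Representation C B
  covariant : R.IsCovariantOn C.katsuraIdeal

attribute [instance] CovariantRep.cstar

/-- Noncommutative polynomials in symbols for the elements of `A`, of `X`, and for the adjoints of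
the elements of `X`. -/
abbrev Poly : Type max u v := FreeNonUnitalNonAssocAlgebra ℂ (C.H.A ⊕ C.H.X ⊕ C.H.X)

variable {C} in
/-- The norm of a polynomial in a covariant representation. -/
def CovariantRep.polyNorm (R : C.CovariantRep) (f : C.Poly) : ℝ :=
  ‖FreeNonUnitalNonAssocAlgebra.lift ℂ
    (Sum.elim R.R.π (Sum.elim R.R.t fun x => star (R.R.t x))) f‖

/-- One covariant representation for each norm function on the polynomials that arises. Up to
isomorphism, these are all covariant representations on `C*`-algebras that they generate. -/
def chosenRep (N : Set.range (CovariantRep.polyNorm (C := C))) : C.CovariantRep := N.2.choose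

/-- The `ℓ^∞`-product of the `C*`-algebras of the chosen covariant representations. -/
abbrev Ambient : Type max u v := lp (fun N => (C.chosenRep N).B) ∞

/-- The product of the chosen representations of `A`. -/
def ambientπ : C.H.A →⋆ₙₐ[ℂ] C.Ambient where
  toFun a := ⟨fun N => (C.chosenRep N).R.π a, memℓp_infty ⟨C.H.p PUnit.unit a, by
    rintro _ ⟨N, rfl⟩
    exact (C.chosenRep N).R.norm_π_le a⟩⟩
  map_smul' c a := by ext N; exact map_smul (C.chosenRep N).R.π c a
  map_zero' := by ext N; exact map_zero (C.chosenRep N).R.π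
  map_add' a b := by ext N; exact map_add (C.chosenRep N).R.π a b
  map_mul' a b := by ext N; exact map_mul (C.chosenRep N).R.π a b
  map_star' a := by ext N; exact map_star (C.chosenRep N).R.π a

/-- The product of the chosen representations of `X`. -/
def ambientT (x : C.H.X) : C.Ambient :=
  ⟨fun N => (C.chosenRep N).R.t x, memℓp_infty ⟨C.H.q PUnit.unit x, by
    rintro _ ⟨N, rfl⟩
    exact (C.chosenRep N).R.norm_t_le x⟩⟩

/-- The `C*`-algebra `O_X`, generated by the images of `A` and `X` under the product of all
covariant representations. -/
def cuntzPimsner : NonUnitalStarSubalgebra ℂ C.Ambient :=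
  (NonUnitalStarAlgebra.adjoin ℂ
    (Set.range C.ambientπ ∪ Set.range C.ambientT)).topologicalClosure

/-- `O_X` as a type. -/
abbrev O : Type max u v := C.cuntzPimsner

instance isClosed_cuntzPimsner : IsClosed (C.cuntzPimsner : Set C.Ambient) :=
  NonUnitalStarSubalgebra.isClosed_topologicalClosure _

instance cstarO : NonUnitalCStarAlgebra C.O := inferInstance

/-- The canonical representation `(π_X, t_X)` of the correspondence on `O_X`. -/
def canonicalRep : Representation C C.O where
  π := NonUnitalStarAlgHom.codRestrict C.ambientπ C.cuntzPimsner fun a =>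
    NonUnitalStarSubalgebra.le_topologicalClosure _
      (NonUnitalStarAlgebra.subset_adjoin _ _ (Or.inl ⟨a, rfl⟩))
  t := fun x => ⟨C.ambientT x, NonUnitalStarSubalgebra.le_topologicalClosure _
      (NonUnitalStarAlgebra.subset_adjoin _ _ (Or.inr ⟨x, rfl⟩))⟩
  continuous_π := by
    rw [PreHilbertPair.topologyA_eq]
    let _ : SeminormedAddCommGroup C.H.A :=
      (C.H.p PUnit.unit).toAddGroupSeminorm.toSeminormedAddCommGroup
    refine AddMonoidHomClass.continuous_of_bound
      (NonUnitalStarAlgHom.codRestrict C.ambientπ C.cuntzPimsner _) 1 fun a => ?_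
    rw [one_mul]
    exact lp.norm_le_of_forall_le (apply_nonneg (C.H.p PUnit.unit) a)
      fun N => (C.chosenRep N).R.norm_π_le a
  star_t_mul_t x y := by
    ext N; exact (C.chosenRep N).R.star_t_mul_t x y
  π_mul_t a x := by
    ext N; exact (C.chosenRep N).R.π_mul_t a x

end PreCorrespondence

/-- `(π, t)` is a universal covariant representation of a `C*`-correspondence on the `C*`-algebra
`B`: it is covariant, `B` is generated by the images of `π` and `t`, and every covariant
representation on a `C*`-algebra factors uniquely through it. -/
structure Representation.IsUniversal {C : PreCorrespondence.{0, u, v} PUnit} {B : Type max u v}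
    [NonUnitalCStarAlgebra B] (R : Representation C B) : Prop where
  covariant : R.IsCovariantOn C.katsuraIdeal
  generates : (NonUnitalStarAlgebra.adjoin ℂ
    (Set.range R.π ∪ Set.range R.t)).topologicalClosure = ⊤
  existsUnique : ∀ (D : Type max u v) [NonUnitalCStarAlgebra D] (S : Representation C D),
    S.IsCovariantOn C.katsuraIdeal →
      ∃! Φ : B →⋆ₙₐ[ℂ] D, (∀ a, Φ (R.π a) = S.π a) ∧ ∀ x, Φ (R.t x) = S.t x

end

end ProCStar

-- The technical core is that elements of the quotients lift with control of all seminorms at once.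
-- Completing `A` for each `p i` gives `C*`-algebras `B i`, and the complete algebra `A` is a closed
-- subalgebra of their product. Functional calculus of a self-adjoint element, done coordinatewise,
-- therefore stays in `A` (`exists_map_eq_cfcₙ`). Cutting off at the height `p l a` yields, for each
-- class in `A_l`, a representative `y` with `p j y ≤ 2 * p l a` for every `j`. A similar cutoff of
-- `⟪x, x⟫` does the same for `X_l`, without the factor (`exists_bounded_lift_A`,
-- `exists_bounded_lift_X`).
--
-- Three facts follow from these lifts. The quotients `A_l` and `X_l` are complete. The induced
-- action `φ_l` is bounded, although continuity of `φ` controls the `l`-th operator seminorm only by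
-- some `p i` with `i` unrelated to `l`. The canonical map from `L(X_l)` to `L(X_m)` is contractive
-- and so preserves compactness. Positive invariance of `ker (p l)` is what makes `φ_l` well
-- defined, and completeness together with directedness identifies `(X, A, φ)` with the inverse
-- limit.
--
-- Negative invariance serves to show that the connecting map from `A_l` to `A_m` carries Katsura's
-- ideal of `X_l` into that of `X_m` (`levelIdeal_subset`). If `a ∈ J_X^l` and `b` acts as zero on
-- `X_m`, then `a * b` lies in `J_X^l` and in `X⁻¹(ker (p m))`, hence vanishes in `A_m`. So the
-- canonical representation of `X_m`, composed with the connecting maps, is a covariant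
-- representation of `X_l`, and the universal property of `O_{X_l}` provides `ρ`.
--
-- That universal property is proved with a graph. In a covariant representation `S` the norm of a
-- polynomial in the generators is at most its norm in `O_X`, so the closed `*`-algebra generated by
-- the pairs of generators projects isomorphically onto `O_X`; the other projection is the required
-- map.
--
-- In the limit, the maps `ψ` of the individual levels are coherent because they agree on rank one
-- operators. An `a ∈ 𝒥_X` has `φ(a)` compact on every `X_l`, hence compact on `X`
-- (`mem_K_of_piL_mem_K`), and covariance can then be checked in each coordinate.

universe w' u' v'

namespace ProCStar

noncomputable section

/-! ### Completion of a pre-`C*`-algebra -/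

namespace CStarCompletion

open UniformSpace UniformSpace.Completion Function

variable (α : Type u) [NonUnitalSeminormedRing α]

/-- The multiplication of the completion of a non-unital seminormed ring. -/
abbrev instMul : Mul (Completion α) :=
  ⟨curry <| (isDenseInducing_coe.prodMap isDenseInducing_coe).extend ((↑) ∘ uncurry (· * ·))⟩

attribute [local instance] instMul

variable {α}

theorem coe_mul (a b : α) : ((a * b : α) : Completion α) = a * b :=
  ((isDenseInducing_coe.prodMap isDenseInducing_coe).extend_eq
      ((continuous_coe α).comp (@continuous_mul α _ _ _)) (a, b)).symm

theorem continuousMul : ContinuousMul (Completion α) where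
  continuous_mul := by
    let m := (AddMonoidHom.mul : α →+ α →+ α).compr₂ toCompl
    have : Continuous fun p : α × α => m p.1 p.2 := (continuous_coe α).comp continuous_mul
    have di : IsDenseInducing (toCompl : α → Completion α) := isDenseInducing_coe
    exact (di.extend_Z_bilin di this :)

attribute [local instance] continuousMul

variable (α) in
/-- The completion of a non-unital seminormed ring as a non-unital ring. -/
abbrev instNonUnitalRing : NonUnitalRing (Completion α) :=
  { (inferInstance : AddCommGroup (Completion α)), (inferInstance : Mul (Completion α)) with
    zero_mul a :=
      Completion.induction_on a (isClosed_eq (by fun_prop) continuous_const)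
        fun a => by rw [← coe_zero, ← coe_mul, zero_mul]
    mul_zero a :=
      Completion.induction_on a (isClosed_eq (by fun_prop) continuous_const)
        fun a ↦ by rw [← coe_zero, ← coe_mul, mul_zero]
    mul_assoc a b c :=
      Completion.induction_on₃ a b c
        (isClosed_eq (by fun_prop) (by fun_prop))
        fun a b c => by rw [← coe_mul, ← coe_mul, ← coe_mul, ← coe_mul, mul_assoc]
    left_distrib a b c :=
      Completion.induction_on₃ a b c
        (isClosed_eq (by fun_prop) (by fun_prop))
        fun a b c => by rw [← coe_add, ← coe_mul, ← coe_mul, ← coe_mul, ← coe_add, mul_add]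
    right_distrib a b c :=
      Completion.induction_on₃ a b c
        (isClosed_eq (by fun_prop) (by fun_prop))
        fun a b c => by rw [← coe_add, ← coe_mul, ← coe_mul, ← coe_mul, ← coe_add, add_mul] }

attribute [local instance] instNonUnitalRing

variable (α) in
/-- The completion of a non-unital seminormed ring as a normed ring. -/
abbrev instNonUnitalNormedRing : NonUnitalNormedRing (Completion α) where
  __ : NormedAddCommGroup (Completion α) := inferInstance
  __ : NonUnitalRing (Completion α) := inferInstance
  norm_mul_le x y := by
    induction x, y using Completion.induction_on₂ with
    | hp => apply isClosed_le <;> fun_prop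
    | ih x y => simpa only [← coe_mul, norm_coe] using norm_mul_le x y

attribute [local instance] instNonUnitalNormedRing

theorem smul_mul [NormedSpace ℂ α] [IsScalarTower ℂ α α] (c : ℂ) (a b : Completion α) :
    c • a * b = c • (a * b) :=
  Completion.induction_on₂ a b
    (isClosed_eq ((continuous_fst.const_smul c).mul continuous_snd)
      ((continuous_fst.mul continuous_snd).const_smul c))
    fun a b => by
      rw [← Completion.coe_smul, ← coe_mul, ← coe_mul, ← Completion.coe_smul, smul_mul_assoc]

theorem mul_smul [NormedSpace ℂ α] [SMulCommClass ℂ α α] (c : ℂ) (a b : Completion α) :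
    a * c • b = c • (a * b) :=
  Completion.induction_on₂ a b
    (isClosed_eq (continuous_fst.mul (continuous_snd.const_smul c))
      ((continuous_fst.mul continuous_snd).const_smul c))
    fun a b => by
      rw [← Completion.coe_smul, ← coe_mul, ← coe_mul, ← Completion.coe_smul, mul_smul_comm]

theorem isScalarTower [NormedSpace ℂ α] [IsScalarTower ℂ α α] :
     IsScalarTower ℂ (Completion α) (Completion α) := ⟨smul_mul⟩

theorem smulCommClass [NormedSpace ℂ α] [SMulCommClass ℂ α α] :
     SMulCommClass ℂ (Completion α) (Completion α) :=
  ⟨fun c a b => (mul_smul c a b).symm⟩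

variable [StarRing α]

variable (α) in
/-- The involution of the completion. -/
abbrev instStar : Star (Completion α) := ⟨Completion.map star⟩

attribute [local instance] instStar

theorem continuous_star' : Continuous (star : Completion α → Completion α) :=
  Completion.continuous_map

variable [NormedStarGroup α]

theorem uniformContinuous_star : UniformContinuous (star : α → α) :=
  (starₗᵢ ℤ : α ≃ₗᵢ⋆[ℤ] α).isometry.uniformContinuous

theorem coe_star (a : α) : ((star a : α) : Completion α) = star (a : Completion α) :=
  (Completion.map_coe uniformContinuous_star a).symm

variable (α) in
/-- The completion as a star ring. -/
abbrev instStarRing : StarRing (Completion α) where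
  star_involutive a := Completion.induction_on a
    (isClosed_eq (continuous_star'.comp continuous_star') continuous_id)
    fun a => by rw [← coe_star, ← coe_star, star_star]
  star_mul a b := Completion.induction_on₂ a b
    (isClosed_eq (continuous_star'.comp continuous_mul)
      ((continuous_star'.comp continuous_snd).mul (continuous_star'.comp continuous_fst)))
    fun a b => by rw [← coe_mul, ← coe_star, ← coe_star, ← coe_star, ← coe_mul, star_mul]
  star_add a b := Completion.induction_on₂ a b
    (isClosed_eq (continuous_star'.comp continuous_add)
      ((continuous_star'.comp continuous_fst).add (continuous_star'.comp continuous_snd)))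
    fun a b => by rw [← coe_add, ← coe_star, ← coe_star, ← coe_star, ← coe_add, star_add]

attribute [local instance] instStarRing

theorem norm_star_mul_self_coe (h : ∀ a : α, ‖star a * a‖ = ‖a‖ ^ 2) (a : Completion α) :
    ‖a‖ * ‖a‖ ≤ ‖star a * a‖ :=
  Completion.induction_on a
    (isClosed_le (continuous_norm.mul continuous_norm)
      (continuous_norm.comp (continuous_star'.mul continuous_id)))
    fun a => by
      rw [← coe_star, ← coe_mul, norm_coe, norm_coe, h, pow_two]

theorem star_smul' [NormedSpace ℂ α] [StarModule ℂ α] (c : ℂ) (a : Completion α) :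
    star (c • a) = star c • star a :=
  Completion.induction_on a
    (isClosed_eq (continuous_star'.comp (continuous_id.const_smul c))
      (continuous_star'.const_smul (star c)))
    fun a => by
      rw [← Completion.coe_smul, ← coe_star, ← coe_star, ← Completion.coe_smul, star_smul]

theorem starModule [NormedSpace ℂ α] [StarModule ℂ α] : StarModule ℂ (Completion α) := ⟨star_smul'⟩

variable [NormedSpace ℂ α] [IsScalarTower ℂ α α] [SMulCommClass ℂ α α] [StarModule ℂ α]

variable (α) in
/-- The completion of a pre-`C*`-algebra is a `C*`-algebra. -/
abbrev instCStar (h : ∀ a : α, ‖star a * a‖ = ‖a‖ ^ 2) :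
    NonUnitalCStarAlgebra (Completion α) :=
  let _ : NormedSpace ℂ (Completion α) := inferInstance
  have : CStarRing (Completion α) := ⟨norm_star_mul_self_coe h⟩
  have := isScalarTower (α := α)
  have := smulCommClass (α := α)
  have := starModule (α := α)
  { }

end CStarCompletion

open UniformSpace in
/-- A `*`-algebra with a `C*`-seminorm has a seminorm preserving `*`-homomorphism to a
`C*`-algebra. -/
theorem exists_cstar_completion {A : Type u} [NonUnitalRing A] [StarRing A] [Module ℂ A]
    [IsScalarTower ℂ A A] [SMulCommClass ℂ A A] [StarModule ℂ A] (p : Seminorm ℂ A)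
    (hmul : ∀ a b, p (a * b) ≤ p a * p b) (hstar : ∀ a, p (star a) = p a)
    (hcstar : ∀ a, p (star a * a) = p a ^ 2) :
    ∃ (B : Type u) (_ : NonUnitalCStarAlgebra B) (φ : A →⋆ₙₐ[ℂ] B), ∀ a, ‖φ a‖ = p a := by
  let _ : NonUnitalSeminormedRing A :=
    { p.toAddGroupSeminorm.toSeminormedAddCommGroup, (inferInstance : NonUnitalRing A) with
      norm_mul_le := hmul }
  let _ : NormedSpace ℂ A := ⟨fun c a => (map_smul_eq_mul p c a).le⟩
  have : NormedStarGroup A := ⟨fun a => (hstar a).le⟩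
  let _ : NonUnitalCStarAlgebra (Completion A) := CStarCompletion.instCStar A hcstar
  refine ⟨Completion A, inferInstance,
    { toFun := fun a => (a : Completion A)
      map_smul' := fun c a => Completion.coe_smul c a
      map_zero' := Completion.coe_zero
      map_add' := fun a b => Completion.coe_add a b
      map_mul' := CStarCompletion.coe_mul
      map_star' := CStarCompletion.coe_star }, fun a => Completion.norm_coe a⟩

theorem comap_seminorm_uniformSpace {E F : Type*} [AddCommGroup E] [AddCommGroup F] [Module ℂ E]
    [Module ℂ F] (p : Seminorm ℂ E) (r : Seminorm ℂ F) (f : E →+ F) (h : ∀ x, r (f x) = p x) :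
    UniformSpace.comap f r.toAddGroupSeminorm.toSeminormedAddCommGroup.toUniformSpace =
      p.toAddGroupSeminorm.toSeminormedAddCommGroup.toUniformSpace := by
  let _ := p.toAddGroupSeminorm.toSeminormedAddCommGroup
  let _ := r.toAddGroupSeminorm.toSeminormedAddCommGroup
  exact (AddMonoidHomClass.isometry_of_norm f h).isUniformInducing.comap_uniformSpace

theorem comap_norm_uniformSpace {E F : Type*} [AddCommGroup E] [SeminormedAddCommGroup F]
    [Module ℂ E] (p : Seminorm ℂ E) (f : E →+ F) (h : ∀ x, ‖f x‖ = p x) :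
    UniformSpace.comap f inferInstance =
      p.toAddGroupSeminorm.toSeminormedAddCommGroup.toUniformSpace := by
  let _ := p.toAddGroupSeminorm.toSeminormedAddCommGroup
  exact (AddMonoidHomClass.isometry_of_norm f h).isUniformInducing.comap_uniformSpace

/-! ### Functional calculus in a pro-`C*`-algebra and bounded lifts -/

namespace PreHilbertPair

variable {ι : Type w} {H : PreHilbertPair.{w, u, v} ι}

section FunctionalCalculus

variable {B : ι → Type u} [∀ i, NonUnitalCStarAlgebra (B i)] {φ : ∀ i, H.A →⋆ₙₐ[ℂ] B i}

/-- The `φ i` preserve the seminorms, so they pull the product uniformity back to that of `A`. For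
complete `A` the image in the product is therefore complete, hence closed. -/
theorem isUniformInducing_pi (hφ : ∀ i a, ‖φ i a‖ = H.p i a) :
    IsUniformInducing fun (a : H.A) i => φ i a := by
  rw [isUniformInducing_iff_uniformSpace, Pi.uniformSpace_eq, UniformSpace.comap_iInf]
  refine iInf_congr fun i => ?_
  refine UniformSpace.comap_comap.symm.trans ?_
  exact comap_norm_uniformSpace (H.p i) ((φ i : H.A →ₙ+* B i) : H.A →+ B i) (hφ i)

/-- The image of `A` in the product is closed, and membership in a closure is tested on finitely
many coordinates. A finite product of `C*`-algebras is a `C*`-algebra, where functional calculus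
stays inside closed `*`-subalgebras. No condition `f 0 = 0` is imposed, since `cfcₙ` takes the value
`0` when it fails. -/
theorem exists_map_eq_cfcₙ [CompleteSpace H.A] (hφ : ∀ i a, ‖φ i a‖ = H.p i a) {a : H.A}
    (ha : IsSelfAdjoint a) {f : ℝ → ℝ} (hf : Continuous f) :
    ∃ y : H.A, ∀ i, φ i y = cfcₙ f (φ i a) := by
  have hcl : IsClosed (Set.range fun (a : H.A) i => φ i a) :=
    (isUniformInducing_pi hφ).isComplete_range.isClosed
  suffices h : (fun i => cfcₙ f (φ i a)) ∈ closure (Set.range fun (a : H.A) i => φ i a) by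
    rw [hcl.closure_eq] at h
    obtain ⟨y, hy⟩ := h
    exact ⟨y, fun i => congrFun hy i⟩
  refine mem_closure_iff.2 fun o ho hmem => ?_
  obtain ⟨F, U, hU, hsub⟩ := isOpen_pi_iff.1 ho _ hmem
  -- Only the coordinates in `F` are constrained by the neighbourhood. The infinite product is not a
  -- `C*`-algebra under the supremum norm, but this finite one is.
  let Φ : H.A →⋆ₙₐ[ℂ] (∀ i : F, B i) :=
    { toFun := fun a i => φ i a
      map_smul' := fun c a => funext fun i => map_smul (φ i) c a
      map_zero' := funext fun i => map_zero (φ i)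
      map_add' := fun a b => funext fun i => map_add (φ i) a b
      map_mul' := fun a b => funext fun i => map_mul (φ i) a b
      map_star' := fun a => funext fun i => map_star (φ i) a }
  have hcS : IsClosed ((NonUnitalStarAlgHom.range Φ).topologicalClosure : Set (∀ i : F, B i)) :=
    NonUnitalStarSubalgebra.isClosed_topologicalClosure _
  have hmem' : cfcₙ f (Φ a) ∈ (NonUnitalStarAlgHom.range Φ).topologicalClosure :=
    cfcₙ_mem f (NonUnitalStarSubalgebra.le_topologicalClosure _ ⟨a, rfl⟩)
  have e : cfcₙ f (Φ a) = fun i : F => cfcₙ f (φ i a) :=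
    cfcₙ_map_pi (S := ℂ) f (Φ a) hf.continuousOn (ha.map Φ) fun i => ha.map (φ i)
  rw [e] at hmem'
  have hO : IsOpen {w : ∀ i : F, B i | ∀ i : F, w i ∈ U i} := by
    have : {w : ∀ i : F, B i | ∀ i : F, w i ∈ U i} = Set.univ.pi fun i : F => U i := by ext; simp
    rw [this]
    exact isOpen_set_pi Set.finite_univ fun i _ => (hU i i.2).1
  obtain ⟨_, hw, y, rfl⟩ := mem_closure_iff.1 hmem' _ hO fun i => (hU i i.2).2
  exact ⟨fun i => φ i y, hsub fun i hi => hw ⟨i, hi⟩, y, rfl⟩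

end FunctionalCalculus

variable (H) in
theorem exists_cstar_family : ∃ (B : ι → Type u) (_ : ∀ i, NonUnitalCStarAlgebra (B i))
    (φ : ∀ i, H.A →⋆ₙₐ[ℂ] B i), ∀ i a, ‖φ i a‖ = H.p i a := by
  choose B hB φ hφ using fun i =>
    exists_cstar_completion (H.p i) (H.p_mul_le i) (p_star i) (H.p_star_mul_self i)
  exact ⟨B, hB, φ, hφ⟩

theorem norm_le_of_mem_quasispectrum {B : Type*} [NonUnitalCStarAlgebra B] {b : B}
    (hb : IsSelfAdjoint b) {t : ℝ} (ht : t ∈ quasispectrum ℝ b) : |t| ≤ ‖b‖ := by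
  have := norm_apply_le_norm_cfcₙ (id : ℝ → ℝ) b ht
  rwa [cfcₙ_id ℝ b] at this

/-- Truncate `a` to the interval `[-r, r]` with `r = p i a`. The truncation is the identity on the
spectrum of the image of `a` in `B i`, so the class in `A_i` is unchanged, while in every other
coordinate the norm becomes at most `r`. -/
theorem exists_bounded_lift_of_isSelfAdjoint [CompleteSpace H.A] (i : ι) {a : H.A}
    (ha : IsSelfAdjoint a) : ∃ y : H.A, H.p i (y - a) = 0 ∧ ∀ j, H.p j y ≤ H.p i a := by
  obtain ⟨B, _, φ, hφ⟩ := H.exists_cstar_family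
  set r := H.p i a
  have hr : 0 ≤ r := apply_nonneg _ _
  have hf : Continuous fun t : ℝ => max (-r) (min r t) := by fun_prop
  obtain ⟨y, hy⟩ := exists_map_eq_cfcₙ hφ ha hf
  refine ⟨y, ?_, fun j => ?_⟩
  · have e : cfcₙ (fun t : ℝ => max (-r) (min r t)) (φ i a) = φ i a := by
      conv_rhs => rw [← cfcₙ_id ℝ (φ i a) (ha.map (φ i))]
      refine cfcₙ_congr fun t ht => ?_
      have h := norm_le_of_mem_quasispectrum (ha.map (φ i)) ht
      rw [hφ] at h
      obtain ⟨h1, h2⟩ := abs_le.1 h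
      change max (-r) (min r t) = t
      rw [min_eq_right h2, max_eq_right h1]
    rw [← hφ, map_sub, hy, e, sub_self, norm_zero]
  · rw [← hφ, hy]
    refine norm_cfcₙ_le fun t _ => ?_
    rw [Real.norm_eq_abs, abs_le]
    exact ⟨le_max_left _ _, max_le (by linarith) (min_le_left _ _)⟩

/-- Every element of `A_i` has a bounded lift to `A`. -/
theorem exists_bounded_lift_A [CompleteSpace H.A] (i : ι) (a : H.A) :
    ∃ y : H.A, H.p i (y - a) = 0 ∧ ∀ j, H.p j y ≤ 2 * H.p i a := by
  -- Real and imaginary parts are lifted separately, which accounts for the factor `2`.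
  set b : H.A := (2⁻¹ : ℂ) • (a + star a) with hb
  set c : H.A := (-Complex.I / 2 : ℂ) • (a - star a) with hc
  have hb' : IsSelfAdjoint b := by
    rw [IsSelfAdjoint, hb, star_smul, star_add, star_star, add_comm]; simp
  have hc' : IsSelfAdjoint c := by
    rw [IsSelfAdjoint, hc, star_smul, star_sub, star_star, ← neg_sub, smul_neg, ← neg_smul]
    congr 1
    simp [neg_div]
  have e : a = b + Complex.I • c := by
    rw [hb, hc, smul_smul]
    have : Complex.I * (-Complex.I / 2) = 2⁻¹ := by
      rw [mul_div_assoc', mul_neg, Complex.I_mul_I]; norm_num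
    rw [this, ← smul_add, add_add_sub_cancel, ← two_smul ℂ a, smul_smul]
    norm_num
  have hpb : H.p i b ≤ H.p i a := by
    have := map_add_le_add (H.p i) a (star a)
    rw [p_star] at this
    rw [hb, map_smul_eq_mul]
    norm_num
    linarith
  have hpc : H.p i c ≤ H.p i a := by
    have := map_sub_le_add (H.p i) a (star a)
    rw [p_star] at this
    rw [hc, map_smul_eq_mul]
    norm_num
    linarith
  obtain ⟨y, hy, hy'⟩ := exists_bounded_lift_of_isSelfAdjoint i hb'
  obtain ⟨z, hz, hz'⟩ := exists_bounded_lift_of_isSelfAdjoint i hc'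
  refine ⟨y + Complex.I • z, ?_, fun j => ?_⟩
  · have : y + Complex.I • z - a = (y - b) + Complex.I • (z - c) := by
      rw [e, smul_sub]; abel
    rw [this]
    refine le_antisymm ((map_add_le_add _ _ _).trans ?_) (apply_nonneg _ _)
    rw [map_smul_eq_mul, hy, hz]; simp
  · refine (map_add_le_add _ _ _).trans ?_
    rw [map_smul_eq_mul, Complex.norm_I, one_mul]
    linarith [hy' j, hz' j]

/-- This is functional calculus for `(1 - k) t (1 - k)`, multiplied out because there is no unit.
The right-hand side is the shape of `⟪x - x y, x - x y⟫` for `b = ⟪x, x⟫` and self-adjoint `y =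
k(b)`. -/
theorem cfcₙ_cutoff {B : Type*} [NonUnitalCStarAlgebra B] {b : B} (hb : IsSelfAdjoint b)
    {k : ℝ → ℝ} (hk : Continuous k) (hk0 : k 0 = 0) :
    cfcₙ (fun t : ℝ => t - t * k t - (k t * t - k t * (t * k t))) b =
      b - b * cfcₙ k b - (cfcₙ k b * b - cfcₙ k b * (b * cfcₙ k b)) := by
  have h1 : Continuous fun t : ℝ => t * k t := by fun_prop
  have h2 : Continuous fun t : ℝ => k t * t := by fun_prop
  have h3 : Continuous fun t : ℝ => k t * (t * k t) := by fun_prop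
  have h4 : Continuous fun t : ℝ => t - t * k t := by fun_prop
  have h5 : Continuous fun t : ℝ => k t * t - k t * (t * k t) := by fun_prop
  have hi : Continuous fun t : ℝ => t := continuous_id
  rw [cfcₙ_sub _ _ b h4.continuousOn (by simp [hk0]) h5.continuousOn (by simp [hk0]),
    cfcₙ_sub _ _ b hi.continuousOn rfl h1.continuousOn (by simp [hk0]),
    cfcₙ_sub _ _ b h2.continuousOn (by simp [hk0]) h3.continuousOn (by simp [hk0]),
    cfcₙ_mul k (fun t => t * k t) b hk.continuousOn hk0 h1.continuousOn (by simp [hk0]),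
    cfcₙ_mul (fun t => t) k b hi.continuousOn rfl hk.continuousOn hk0,
    cfcₙ_mul k (fun t => t) b hk.continuousOn hk0 hi.continuousOn rfl,
    cfcₙ_id' ℝ b hb]

/-- Every element of `X_i` has a bounded lift to `X`. -/
theorem exists_bounded_lift_X [CompleteSpace H.A] (i : ι) (x : H.X) :
    ∃ y : H.X, H.q i (y - x) = 0 ∧ ∀ j, H.q j y ≤ H.q i x := by
  set r := H.q i x with hr
  have hr0 : 0 ≤ r := apply_nonneg _ _
  rcases hr0.eq_or_lt with h0 | hpos
  · exact ⟨0, by rw [zero_sub, map_neg_eq_map, ← hr, h0], fun j => by rw [map_zero]; exact hr0⟩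
  obtain ⟨B, _, φ, hφ⟩ := H.exists_cstar_family
  set b := H.inner x x
  have hb : IsSelfAdjoint b := H.star_inner x x
  -- The lift is to be `x` times `r / max r √|b|`, which shortens `x` to length at most `r`. Without
  -- a unit one subtracts `x k(b)` instead, with `k 0 = 0`; this and the continuity of `k` need `r >
  -- 0`, so `r = 0` was treated apart. The absolute value makes positivity of the spectrum of `b`
  -- unnecessary.
  set k : ℝ → ℝ := fun t => 1 - r / max r √|t| with hk
  have hm : ∀ t : ℝ, 0 < max r √|t| := fun t => lt_max_of_lt_left hpos
  have hkc : Continuous k :=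
    continuous_const.sub (continuous_const.div (by fun_prop) fun t => (hm t).ne')
  have hk0 : k 0 = 0 := by simp [hk, hpos.le, hpos.ne']
  obtain ⟨y, hy⟩ := exists_map_eq_cfcₙ hφ hb hkc
  refine ⟨x - H.rsmul x y, ?_, fun j => ?_⟩
  -- On the spectrum in `B i` one has `√|t| ≤ r`, because the norm of `b` there is `r ^ 2`. So `k`
  -- vanishes on it and the correction `x y` is zero in `X_i`.
  · have hy0 : H.p i y = 0 := by
      rw [← hφ, hy, norm_eq_zero, ← cfcₙ_const_zero ℝ (φ i b)]
      refine cfcₙ_congr fun t ht => ?_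
      have h := norm_le_of_mem_quasispectrum (hb.map (φ i)) ht
      rw [hφ, ← q_sq] at h
      have h2 : √|t| ≤ r := Real.sqrt_le_iff.2 ⟨hr0, h⟩
      simp [hk, max_eq_left h2, hpos.ne']
    rw [sub_sub_cancel_left, map_neg_eq_map]
    refine le_antisymm ((q_rsmul_le i x y).trans ?_) (apply_nonneg _ _)
    rw [hy0, mul_zero]
  · refine le_of_sq_le_sq ?_ hr0
    rw [q_sq, ← hφ]
    have hbj : IsSelfAdjoint (φ j b) := hb.map (φ j)
    have e : φ j (H.inner (x - H.rsmul x y) (x - H.rsmul x y)) =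
        cfcₙ (fun t : ℝ => t - t * k t - (k t * t - k t * (t * k t))) (φ j b) := by
      rw [cfcₙ_cutoff hbj hkc hk0, ← hy]
      have hs : star (φ j y) = φ j y := by
        rw [hy]; exact cfcₙ_predicate k (φ j b)
      simp only [inner_sub_left, inner_sub_right, inner_rsmul_left, H.inner_rsmul_right, map_sub,
        map_mul, map_star, hs, b]
      noncomm_ring
    rw [e]
    refine norm_cfcₙ_le fun t _ => ?_
    have e2 : t - t * k t - (k t * t - k t * (t * k t)) = t * (r / max r √|t|) ^ 2 := by
      simp only [hk]; ring
    rw [e2, Real.norm_eq_abs, abs_mul, abs_of_nonneg (sq_nonneg (r / max r √|t|)), div_pow,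
      mul_div_assoc', div_le_iff₀ (pow_pos (hm t) 2), mul_comm]
    refine mul_le_mul_of_nonneg_left ?_ (sq_nonneg r)
    calc |t| = √|t| ^ 2 := (Real.sq_sqrt (abs_nonneg t)).symm
      _ ≤ _ := pow_le_pow_left₀ (Real.sqrt_nonneg _) (le_max_right _ _) 2

end PreHilbertPair

/-- The uniform structure of a seminorm. -/
abbrev seminormUniformSpace {E : Type*} [AddCommGroup E] [Module ℂ E] (p : Seminorm ℂ E) :
    UniformSpace E :=
  p.toAddGroupSeminorm.toSeminormedAddCommGroup.toUniformSpace

/-! ### Spaces with a family of seminorms: separation, complete quotients, inverse limits -/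

section SeminormFamily

variable {ι : Type*} {E : Type*} [AddCommGroup E] [Module ℂ E] {p : ι → Seminorm ℂ E}

theorem continuous_of_seminorm_le {F : Type*} [AddCommGroup F] [Module ℂ F]
    {r : Seminorm ℂ F} {q : Seminorm ℂ E} (f : E →+ F) (h : ∀ x, r (f x) ≤ q x) :
    @Continuous E F (seminormUniformSpace q).toTopologicalSpace
      (seminormUniformSpace r).toTopologicalSpace f := by
  let _ := q.toAddGroupSeminorm.toSeminormedAddCommGroup
  let _ := r.toAddGroupSeminorm.toSeminormedAddCommGroup
  refine AddMonoidHomClass.continuous_of_bound f 1 fun x => ?_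
  rw [one_mul]
  exact h x

theorem continuous_seminorm_sub (q : Seminorm ℂ E) (y : E) :
    @Continuous E ℝ (seminormUniformSpace q).toTopologicalSpace _ fun x => q (x - y) := by
  let _ := q.toAddGroupSeminorm.toSeminormedAddCommGroup
  exact continuous_norm.comp (continuous_id.sub continuous_const)

theorem cauchySeq_of_seminorm_bounded (q : Seminorm ℂ E) {x : ℕ → E} {g : ℕ → ℝ}
    (hg : Summable g) (h : ∀ n, q (x n) ≤ g n) :
    @CauchySeq E ℕ (seminormUniformSpace q) _ fun n => ∑ k ∈ Finset.range n, x k := by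
  let _ := q.toAddGroupSeminorm.toSeminormedAddCommGroup
  exact cauchySeq_range_of_norm_bounded hg.hasSum.tendsto_sum_nat.cauchySeq h

/-- The functions `x ↦ p i (x - y)`, over all `i` and `y`, form a continuous map into a product of
lines; taking `y` to be the second point shows that it is injective. -/
theorem t2Space_of_seminorms [u : UniformSpace E] (hE : u = ⨅ i, seminormUniformSpace (p i))
    (hsep : ∀ x, (∀ i, p i x = 0) → x = 0) : T2Space E := by
  have hc : Continuous fun (x : E) (j : ι × E) => p j.1 (x - j.2) := by
    refine continuous_pi fun j => ?_
    rw [hE, UniformSpace.toTopologicalSpace_iInf]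
    refine continuous_iInf_dom (i := j.1) ?_
    exact continuous_seminorm_sub (p j.1) j.2
  refine T2Space.of_injective_continuous (fun x y hxy => ?_) hc
  rw [← sub_eq_zero]
  refine hsep _ fun i => ?_
  have := congrFun hxy (i, y)
  simpa using this

/-- The image of a complete space under a map with bounded lifts is complete. -/
theorem completeSpace_of_bounded_lift [u : UniformSpace E]
    (hE : u = ⨅ i, seminormUniformSpace (p i)) [CompleteSpace E] (i : ι) {F : Type*}
    [AddCommGroup F] [Module ℂ F] (r : Seminorm ℂ F) (hr : ∀ y, r y = 0 → y = 0) (f : E →+ F)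
    (hf : Function.Surjective f) (h : ∀ x, r (f x) = p i x) (C : ℝ)
    (lift : ∀ x, ∃ y, p i (y - x) = 0 ∧ ∀ j, p j y ≤ C * p i x) :
    @CompleteSpace F (seminormUniformSpace r) := by
  let _ : NormedAddCommGroup F :=
    AddGroupNorm.toNormedAddCommGroup
      { r.toAddGroupSeminorm with eq_zero_of_map_eq_zero' := hr }
  have lift' : ∀ z : F, ∃ y, f y = z ∧ ∀ j, p j y ≤ C * ‖z‖ := by
    refine hf.forall.2 fun x => ?_
    obtain ⟨y, hy, hb⟩ := lift x
    refine ⟨y, ?_, fun j => ?_⟩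
    · rw [← sub_eq_zero, ← map_sub]
      exact hr _ (by rw [h, hy])
    · change p j y ≤ C * r (f x)
      rw [h]
      exact hb j
  choose g hg hgb using lift'
  refine NormedAddCommGroup.completeSpace_of_summable_imp_tendsto fun v hv => ?_
  -- The lifts of an absolutely summable series are dominated by the same summable sequence for
  -- every seminorm. The lifted series thus converges in `E`, and its sum maps to the sum
  -- downstairs.
  have hc : CauchySeq fun n => ∑ k ∈ Finset.range n, g (v k) := by
    have : Nonempty ι := ⟨i⟩
    rw [CauchySeq, hE, cauchy_iInf_uniformSpace]
    intro j
    exact cauchySeq_of_seminorm_bounded (p j) (hv.mul_left C) fun n => hgb (v n) j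
  obtain ⟨s, hs⟩ := cauchySeq_tendsto_of_complete hc
  refine ⟨f s, ?_⟩
  have hfc : Continuous f := by
    rw [hE, UniformSpace.toTopologicalSpace_iInf]
    refine continuous_iInf_dom (i := i) ?_
    exact continuous_of_seminorm_le (r := r) f fun x => (h x).le
  have := (hfc.tendsto s).comp hs
  simpa [Function.comp_def, hg] using this

variable {F : ι → Type*} [∀ i, AddCommGroup (F i)] [∀ i, Module ℂ (F i)]
  [uF : ∀ i, UniformSpace (F i)]

theorem isUniformInducing_of_seminorms [u : UniformSpace E]
    (hE : u = ⨅ i, seminormUniformSpace (p i)) {r : ∀ i, Seminorm ℂ (F i)}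
    (hF : ∀ i, uF i = seminormUniformSpace (r i)) (f : ∀ i, E →+ F i)
    (hf : ∀ i x, r i (f i x) = p i x) : IsUniformInducing fun x i => f i x := by
  rw [isUniformInducing_iff_uniformSpace, Pi.uniformSpace_eq, UniformSpace.comap_iInf, hE]
  refine iInf_congr fun i => ?_
  refine UniformSpace.comap_comap.symm.trans ?_
  rw [hF]
  exact comap_seminorm_uniformSpace (p i) (r i) (f i) (hf i)

omit [Module ℂ E] [∀ i, Module ℂ (F i)] in
/-- A complete space is the inverse limit of its quotients by a directed family of seminorms. -/
theorem range_eq_coherent [Preorder ι] [IsDirectedOrder ι] [Nonempty ι] [∀ i, T2Space (F i)]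
    [UniformSpace E] [CompleteSpace E] (f : ∀ i, E →+ F i)
    (hf : IsUniformInducing fun x i => f i x) (hs : ∀ i, Function.Surjective (f i))
    (g : ∀ ⦃m l : ι⦄, m ≤ l → F l → F m)
    (hg : ∀ ⦃m l : ι⦄ (h : m ≤ l) x, g h (f l x) = f m x) :
    Set.range (fun x i => f i x) = {y | ∀ m l (h : m ≤ l), g h (y l) = y m} := by
  refine Set.Subset.antisymm ?_ fun y hy => ?_
  · rintro _ ⟨x, rfl⟩ m l h
    exact hg h x
  -- Closedness of the range reduces the claim to approximation on finitely many coordinates. By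
  -- directedness some `l` lies above all of them, and a preimage of `y l` then agrees with `y`
  -- exactly there.
  · rw [← hf.isComplete_range.isClosed.closure_eq]
    refine mem_closure_iff.2 fun o ho hmem => ?_
    obtain ⟨I, U, hU, hsub⟩ := isOpen_pi_iff.1 ho _ hmem
    obtain ⟨l, hl⟩ := I.exists_le
    obtain ⟨x, hx⟩ := hs l (y l)
    refine ⟨fun i => f i x, hsub fun i hi => ?_, x, rfl⟩
    rw [← hg (hl i hi), hx, hy i l (hl i hi)]
    exact (hU i hi).2

end SeminormFamily

/-! ### Completeness of `A_i` and `X_i`, and their connecting maps -/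

namespace PreHilbertPair

variable {ι : Type w} {H : PreHilbertPair.{w, u, v} ι}

theorem q_separating (x : H.X) (h : ∀ i, H.q i x = 0) : x = 0 := by
  refine H.inner_self_eq_zero x (H.p_separating _ fun i => ?_)
  rw [← q_sq, h, zero_pow two_ne_zero]

instance t2SpaceA : T2Space H.A := t2Space_of_seminorms rfl H.p_separating

instance t2SpaceX : T2Space H.X := t2Space_of_seminorms rfl q_separating

theorem uniformSpaceA_level (i : ι) :
    (H.level i).uniformSpaceA = seminormUniformSpace (H.levelP i) :=
  ciInf_unique (ι := PUnit)

theorem uniformSpaceX_level (i : ι) :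
    (H.level i).uniformSpaceX = seminormUniformSpace (H.levelQ i) :=
  ciInf_unique (ι := PUnit)

instance completeSpaceA_level [CompleteSpace H.A] (i : ι) : CompleteSpace (H.level i).A := by
  rw [uniformSpaceA_level]
  exact completeSpace_of_bounded_lift (p := H.p) rfl i (H.levelP i)
    ((mkA_surjective i).forall.2 fun a h => mkA_eq_zero.2 h) (H.mkA i).toAddMonoidHom
    (mkA_surjective i) (levelP_mkA i) 2 (exists_bounded_lift_A i)

instance completeSpaceX_level [CompleteSpace H.A] [CompleteSpace H.X] (i : ι) :
    CompleteSpace (H.level i).X := by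
  rw [uniformSpaceX_level]
  exact completeSpace_of_bounded_lift (p := H.q) rfl i (H.levelQ i)
    ((mkX_surjective i).forall.2 fun a h => mkX_eq_zero.2 h) (H.mkX i).toAddMonoidHom
    (mkX_surjective i) (levelQ_mkX i) 1 (by simpa using exists_bounded_lift_X i)

theorem isUniformInducing_piA : IsUniformInducing fun (a : H.A) i => H.piA i a :=
  isUniformInducing_of_seminorms (p := H.p) (F := fun i => (H.level i).A) rfl uniformSpaceA_level
    (fun i => (H.mkA i).toAddMonoidHom) levelP_mkA

theorem isUniformInducing_sigmaX : IsUniformInducing fun (x : H.X) i => H.sigmaX i x :=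
  isUniformInducing_of_seminorms (p := H.q) (F := fun i => (H.level i).X) rfl uniformSpaceX_level
    (fun i => (H.mkX i).toAddMonoidHom) levelQ_mkX

theorem isEmbedding_piA : IsEmbedding fun (a : H.A) i => H.piA i a :=
  isUniformInducing_piA.isUniformEmbedding.isEmbedding

theorem isEmbedding_sigmaX : IsEmbedding fun (x : H.X) i => H.sigmaX i x :=
  isUniformInducing_sigmaX.isUniformEmbedding.isEmbedding

section Trans

variable {m l : ι} (h : H.p m ≤ H.p l)

theorem continuous_piTrans : Continuous (H.piTrans h) := by
  rw [uniformSpaceA_level, uniformSpaceA_level]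
  exact continuous_of_seminorm_le (q := H.levelP l) (r := H.levelP m)
    ((H.piTrans h : (H.level l).A →ₙ+* (H.level m).A) : (H.level l).A →+ (H.level m).A)
    ((H.piA_surjective l).forall.2 h)

theorem continuous_sigmaTrans : Continuous (H.sigmaTrans h) := by
  rw [uniformSpaceX_level, uniformSpaceX_level]
  exact continuous_of_seminorm_le (q := H.levelQ l) (r := H.levelQ m)
    (H.sigmaTrans h).toAddMonoidHom
    ((H.sigmaX_surjective l).forall.2 (q_le_of_p_le h))

theorem inner_sigmaTrans (x y : (H.level l).X) :
    (H.level m).inner (H.sigmaTrans h x) (H.sigmaTrans h y) =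
      H.piTrans h ((H.level l).inner x y) := by
  obtain ⟨x, rfl⟩ := H.sigmaX_surjective l x
  obtain ⟨y, rfl⟩ := H.sigmaX_surjective l y
  rfl

theorem rsmul_sigmaX (i : ι) (x : H.X) (a : H.A) :
    (H.level i).rsmul (H.sigmaX i x) (H.piA i a) = H.sigmaX i (H.rsmul x a) := rfl

theorem rsmul_sigmaTrans (x : (H.level l).X) (a : (H.level l).A) :
    (H.level m).rsmul (H.sigmaTrans h x) (H.piTrans h a) =
      H.sigmaTrans h ((H.level l).rsmul x a) := by
  obtain ⟨x, rfl⟩ := H.sigmaX_surjective l x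
  obtain ⟨a, rfl⟩ := H.piA_surjective l a
  rfl

end Trans

end PreHilbertPair

namespace PreHilbertPair

/-! ### Maps between algebras of operators -/

section Shortcuts

variable {ι : Type w} (H : PreHilbertPair.{w, u, v} ι)

set_option synthInstance.maxHeartbeats 100000

instance nonUnitalNonAssocRingK : NonUnitalNonAssocRing H.K := inferInstance

instance nonUnitalNonAssocSemiringK : NonUnitalNonAssocSemiring H.K := inferInstance

instance addCommMonoidK : AddCommMonoid H.K := inferInstance

instance addMonoidK : AddMonoid H.K := inferInstance

instance moduleK : Module ℂ H.K := inferInstance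

instance distribMulActionK : DistribMulAction ℂ H.K := inferInstance

end Shortcuts

section Maps

variable {ι : Type w} {H : PreHilbertPair.{w, u, v} ι} {ι' : Type w'}
  {H' : PreHilbertPair.{w', u', v'} ι'}

theorem continuous_of_opSeminorm_le (f : H.L →⋆ₙₐ[ℂ] H'.L) (σ : ι' → ι)
    (h : ∀ i T, opSeminorm i (f T) ≤ opSeminorm (σ i) T) : Continuous f := by
  refine continuous_iInf_rng.2 fun i => continuous_iInf_dom (i := σ i) ?_
  let _ := H.opDist (σ i)
  let _ := H'.opDist i
  refine LipschitzWith.continuous (K := 1) fun T S => ?_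
  change opSeminorm i (f T - f S) ≤ ((1 : ℝ≥0) : ℝ≥0∞) * opSeminorm (σ i) (T - S)
  rw [ENNReal.coe_one, one_mul, ← map_sub]
  exact h i _

theorem map_mem_finiteRank (f : H.L →⋆ₙₐ[ℂ] H'.L)
    (hf : ∀ y x, f (theta y x) ∈ H'.finiteRank) {T : H.L} (hT : T ∈ H.finiteRank) :
    f T ∈ H'.finiteRank := by
  induction hT using Submodule.span_induction with
  | mem T h => obtain ⟨y, x, rfl⟩ := h; exact hf y x
  | zero => rw [map_zero]; exact zero_mem _
  | add T S _ _ hT hS => rw [map_add]; exact add_mem hT hS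
  | smul c T _ hT => rw [map_smul]; exact Submodule.smul_mem _ _ hT

theorem map_mem_K (f : H.L →⋆ₙₐ[ℂ] H'.L) (hc : Continuous f)
    (hf : ∀ y x, f (theta y x) ∈ H'.finiteRank) {T : H.L} (hT : T ∈ H.K) : f T ∈ H'.K :=
  map_mem_closure hc hT fun _ h => map_mem_finiteRank f hf h

/-- The restriction of a `*`-homomorphism of operator algebras to the compact operators. -/
def mapK (f : H.L →⋆ₙₐ[ℂ] H'.L) (hf : ∀ T ∈ H.K, f T ∈ H'.K) : H.K →⋆ₙₐ[ℂ] H'.K where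
  toFun T := ⟨f T, hf T T.2⟩
  map_smul' c T := Subtype.ext (map_smul f c T.1)
  map_zero' := Subtype.ext (map_zero f)
  map_add' T S := Subtype.ext (map_add f T.1 S.1)
  map_mul' T S := Subtype.ext (map_mul f T.1 S.1)
  map_star' T := Subtype.ext (map_star f T.1)

theorem continuous_mapK (f : H.L →⋆ₙₐ[ℂ] H'.L) (hf : ∀ T ∈ H.K, f T ∈ H'.K)
    (hc : Continuous f) : Continuous (mapK f hf) :=
  (hc.comp continuous_subtype_val).subtype_mk _

theorem denseRange_finiteRank_K :
    DenseRange (fun T : H.finiteRank => (⟨T.1, subset_closure T.2⟩ : H.K)) := by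
  intro T
  rw [closure_subtype]
  refine closure_mono ?_ T.2
  intro S hS
  exact ⟨_, ⟨⟨S, hS⟩, rfl⟩, rfl⟩

variable {B : Type*} [NonUnitalRing B] [StarRing B] [Module ℂ B] [TopologicalSpace B]

/-- Continuous `*`-homomorphisms on `K(X)` are determined by their values on rank one operators. -/
theorem ext_K [T2Space B] {ψ ψ' : H.K →⋆ₙₐ[ℂ] B} (hψ : Continuous ψ) (hψ' : Continuous ψ')
    (h : ∀ y x, ψ ⟨theta y x, theta_mem_K y x⟩ = ψ' ⟨theta y x, theta_mem_K y x⟩) : ψ = ψ' := by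
  have hfin : ∀ T (hT : T ∈ H.finiteRank), ψ ⟨T, subset_closure hT⟩ = ψ' ⟨T, subset_closure hT⟩ := by
    intro T hT
    induction hT using Submodule.span_induction with
    | mem T hT => obtain ⟨y, x, rfl⟩ := hT; exact h y x
    | zero => exact (map_zero ψ).trans (map_zero ψ').symm
    | add T S hT hS h1 h2 =>
      exact (map_add ψ _ _).trans ((congrArg₂ (· + ·) h1 h2).trans (map_add ψ' _ _).symm)
    | smul c T hT h1 =>
      exact (ψ.map_smul' c _).trans ((congrArg (c • ·) h1).trans (ψ'.map_smul' c _).symm)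
  exact DFunLike.coe_injective
    (denseRange_finiteRank_K.equalizer hψ hψ' (funext fun T => hfin T.1 T.2))

/-- A closed subalgebra contains the image of `K(X)` if it contains the images of the rank one
operators. -/
theorem map_K_mem {ψ : H.K →⋆ₙₐ[ℂ] B} (hψ : Continuous ψ) (S : NonUnitalStarSubalgebra ℂ B)
    (hS : IsClosed (S : Set B)) (h : ∀ y x, ψ ⟨theta y x, theta_mem_K y x⟩ ∈ S) (T : H.K) :
    ψ T ∈ S := by
  have hfin : ∀ T (hT : T ∈ H.finiteRank), ψ ⟨T, subset_closure hT⟩ ∈ S := by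
    intro T hT
    induction hT using Submodule.span_induction with
    | mem T hT => obtain ⟨y, x, rfl⟩ := hT; exact h y x
    | zero => exact (map_zero ψ).symm ▸ zero_mem S
    | add T T' hT hT' h1 h2 => exact (map_add ψ ⟨T, _⟩ ⟨T', _⟩).symm ▸ add_mem h1 h2
    | smul c T hT h1 =>
      have e := ψ.map_smul' c ⟨T, subset_closure hT⟩
      have h2 : c • ψ ⟨T, subset_closure hT⟩ ∈ S := SMulMemClass.smul_mem c h1
      exact (congrArg (· ∈ S) e).mpr h2
  exact denseRange_finiteRank_K.induction_on T (hS.preimage hψ) fun T => hfin T.1 T.2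

end Maps

section Ideal

variable {ι : Type w} {H : PreHilbertPair.{w, u, v} ι}

theorem theta_mul (y x : H.X) (S : H.L) : theta y x * S = theta y ((star S).1 x) := by
  refine Subtype.ext (LinearMap.ext fun z => ?_)
  change H.rsmul y (H.inner x (S.1 z)) = H.rsmul y (H.inner _ z)
  rw [inner_star']

theorem finiteRank_mul_L {T : H.L} (hT : T ∈ H.finiteRank) (S : H.L) :
    T * S ∈ H.finiteRank := by
  induction hT using Submodule.span_induction with
  | mem T h => obtain ⟨y, x, rfl⟩ := h; rw [theta_mul]; exact theta_mem _ _
  | zero => rw [zero_mul]; exact zero_mem _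
  | add T S _ _ hT hS => rw [add_mul]; exact add_mem hT hS
  | smul c T _ hT => rw [smul_mul_assoc]; exact Submodule.smul_mem _ _ hT

/-- Finite rank operators form a right ideal, by `theta_mul`. Finiteness of the seminorms of `S`
makes right multiplication by `S` Lipschitz, so the ideal property passes to the closure. -/
theorem K_mul_L {T : H.L} (hT : T ∈ H.K) {S : H.L} (hS : ∀ i, opSeminorm i S ≠ ∞) :
    T * S ∈ H.K := by
  refine map_mem_closure (f := fun T : H.L => T * S) (continuousL fun i =>
    ⟨(opSeminorm i S).toNNReal, fun T T' => ?_⟩) hT fun T' hT' => finiteRank_mul_L hT' S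
  rw [← sub_mul, ENNReal.coe_toNNReal (hS i)]
  exact opSeminorm_mul_le' i _ S (hS i)

end Ideal

/-! ### Operators on the quotients `X_i` -/

section Levels

variable {ι : Type w} {H : PreHilbertPair.{w, u, v} ι}

/-- Both suprema run over the same numbers, since `σ_i` is surjective and `σ_i x` has norm `q i x`.
-/
theorem opSeminorm_piL (i : ι) (T : H.L) :
    opSeminorm PUnit.unit (H.piL i T) = opSeminorm i T :=
  ((H.sigmaX_surjective i).iSup_comp
    (g := fun x => ⨆ (_ : (H.level i).q PUnit.unit x ≤ 1),
      ENNReal.ofReal ((H.level i).q PUnit.unit ((H.piL i T).1 x)))).symm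

theorem continuous_piL (i : ι) : Continuous (H.piL i) :=
  continuous_of_opSeminorm_le _ (fun _ => i) fun _ T => (opSeminorm_piL i T).le

theorem piL_theta (i : ι) (y x : H.X) :
    H.piL i (theta y x) = theta (H.sigmaX i y) (H.sigmaX i x) := ext_level fun _ => rfl

theorem piL_mem_K (i : ι) {T : H.L} (hT : T ∈ H.K) : H.piL i T ∈ (H.level i).K :=
  map_mem_K (H.piL i) (continuous_piL i) (fun y x => by rw [piL_theta]; exact theta_mem _ _) hT

variable {m l : ι} (h : H.p m ≤ H.p l)

/-- The square `⟪T x, T x⟫ = ⟪x, T* T x⟫` is sent by the connecting map to `⟪σ x, σ (T* T x)⟫ = 0`.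
This is what lets operators descend from `X_l` to `X_m`. -/
theorem sigmaTrans_apply_eq_zero (T : (H.level l).L) {x : (H.level l).X}
    (hx : H.sigmaTrans h x = 0) : H.sigmaTrans h (T.1 x) = 0 := by
  refine (H.level m).inner_self_eq_zero _ ?_
  rw [inner_sigmaTrans, inner_star, ← inner_sigmaTrans, hx, ← (H.level m).star_inner,
    inner_zero_right, star_zero]

/-- The linear map on `X_m` induced by an operator on `X_l`. -/
def transEnd (T : (H.level l).L) : Module.End ℂ (H.level m).X :=
  (H.kerX m).liftQ (H.sigmaTrans h ∘ₗ T.1 ∘ₗ H.sigmaX l) fun _ hx =>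
    LinearMap.mem_ker.2 (sigmaTrans_apply_eq_zero h T (sigmaX_eq_zero.2 hx))

theorem transEnd_sigmaTrans (T : (H.level l).L) (x : (H.level l).X) :
    transEnd h T (H.sigmaTrans h x) = H.sigmaTrans h (T.1 x) := by
  obtain ⟨x, rfl⟩ := H.sigmaX_surjective l x
  rfl

theorem sigmaTrans_surjective : Function.Surjective (H.sigmaTrans h) := fun x => by
  obtain ⟨x, rfl⟩ := H.sigmaX_surjective m x
  exact ⟨H.sigmaX l x, rfl⟩

/-- The operator on `X_m` induced by an operator on `X_l`. -/
def transOp (T : (H.level l).L) : (H.level m).L :=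
  ⟨transEnd h T, transEnd h (star T), (sigmaTrans_surjective h).forall₂.2 fun x y => by
    rw [transEnd_sigmaTrans, transEnd_sigmaTrans, inner_sigmaTrans, inner_sigmaTrans, inner_star]⟩

theorem transOp_sigmaTrans (T : (H.level l).L) (x : (H.level l).X) :
    (transOp h T).1 (H.sigmaTrans h x) = H.sigmaTrans h (T.1 x) := transEnd_sigmaTrans h T x

theorem ext_trans {T S : (H.level m).L}
    (hTS : ∀ x, T.1 (H.sigmaTrans h x) = S.1 (H.sigmaTrans h x)) : T = S :=
  Subtype.ext (LinearMap.ext ((sigmaTrans_surjective h).forall.2 hTS))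

/-- The canonical map `L(X_l) → L(X_m)`. -/
def transL : (H.level l).L →⋆ₙₐ[ℂ] (H.level m).L where
  toFun := transOp h
  map_smul' c T := ext_trans h fun x => by
    change _ = c • (transOp h T).1 _
    rw [transOp_sigmaTrans, transOp_sigmaTrans, ← map_smul]
    rfl
  map_zero' := ext_trans h fun x => by
    rw [transOp_sigmaTrans]
    exact map_zero _
  map_add' T S := ext_trans h fun x => by
    change _ = (transOp h T).1 _ + (transOp h S).1 _
    rw [transOp_sigmaTrans, transOp_sigmaTrans, transOp_sigmaTrans, ← map_add]
    rfl
  map_mul' T S := ext_trans h fun x => by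
    change _ = (transOp h T).1 ((transOp h S).1 _)
    rw [transOp_sigmaTrans, transOp_sigmaTrans, transOp_sigmaTrans]
    rfl
  map_star' T := extL <| (sigmaTrans_surjective h).forall₂.2 fun x y => by
    rw [← inner_star]
    rw [transOp_sigmaTrans, transOp_sigmaTrans, inner_sigmaTrans, inner_sigmaTrans, inner_star]

theorem transL_sigmaTrans (T : (H.level l).L) (x : (H.level l).X) :
    (transL h T).1 (H.sigmaTrans h x) = H.sigmaTrans h (T.1 x) := transEnd_sigmaTrans h T x

theorem transL_piL (T : H.L) : transL h (H.piL l T) = H.piL m T := ext_level fun _ => rfl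

theorem transL_theta (y x : (H.level l).X) :
    transL h (theta y x) = theta (H.sigmaTrans h y) (H.sigmaTrans h x) :=
  ext_trans h fun z => by
    rw [transL_sigmaTrans, theta_apply, theta_apply, inner_sigmaTrans, rsmul_sigmaTrans]

theorem q_sigmaTrans_le (x : (H.level l).X) :
    (H.level m).q PUnit.unit (H.sigmaTrans h x) ≤ (H.level l).q PUnit.unit x := by
  obtain ⟨x, rfl⟩ := H.sigmaX_surjective l x
  exact q_le_of_p_le h x

/-- By the bounded lifts, the unit ball of `X_l` maps onto that of `X_m`, and the connecting map
does not increase norms. Hence the supremum on `X_m` is at most that on `X_l`. -/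
theorem opSeminorm_transL_le [CompleteSpace H.A] (T : (H.level l).L) :
    opSeminorm PUnit.unit (transL h T) ≤ opSeminorm PUnit.unit T := by
  refine iSup₂_le ((H.sigmaX_surjective m).forall.2 fun x hx => ?_)
  obtain ⟨y, hy, hb⟩ := exists_bounded_lift_X m x
  have e : H.sigmaX m x = H.sigmaTrans h (H.sigmaX l y) := by
    rw [sigmaTrans_sigmaX, eq_comm, ← sub_eq_zero, ← map_sub]
    exact sigmaX_eq_zero.2 hy
  rw [e, transL_sigmaTrans]
  refine le_trans (ENNReal.ofReal_le_ofReal (q_sigmaTrans_le h _)) ?_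
  have hy1 : (H.level l).q PUnit.unit (H.sigmaX l y) ≤ 1 := (hb l).trans hx
  exact le_iSup₂ (f := fun x (_ : (H.level l).q PUnit.unit x ≤ 1) =>
    ENNReal.ofReal ((H.level l).q PUnit.unit (T.1 x))) _ hy1

theorem continuous_transL [CompleteSpace H.A] : Continuous (transL h) :=
  continuous_of_opSeminorm_le _ id fun _ T => opSeminorm_transL_le h T

theorem transL_mem_K [CompleteSpace H.A] {T : (H.level l).L} (hT : T ∈ (H.level l).K) :
    transL h T ∈ (H.level m).K :=
  map_mem_K (transL h) (continuous_transL h)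
    (fun y x => by rw [transL_theta]; exact theta_mem _ _) hT

-- This is not a termwise comparison: passing from `l` to `m` lowers the seminorm but enlarges the
-- unit ball over which the supremum is taken. Bounded lifts compensate for the latter.
include h in
theorem opSeminorm_mono [CompleteSpace H.A] (T : H.L) : opSeminorm m T ≤ opSeminorm l T := by
  rw [← opSeminorm_piL m, ← opSeminorm_piL l, ← transL_piL h]
  exact opSeminorm_transL_le h _

theorem exists_finiteRank_lift (i : ι) {T : (H.level i).L} (hT : T ∈ (H.level i).finiteRank) :
    ∃ S ∈ H.finiteRank, H.piL i S = T := by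
  induction hT using Submodule.span_induction with
  | mem T hT =>
    obtain ⟨y, x, rfl⟩ := hT
    obtain ⟨y, rfl⟩ := H.sigmaX_surjective i y
    obtain ⟨x, rfl⟩ := H.sigmaX_surjective i x
    exact ⟨theta y x, theta_mem y x, piL_theta i y x⟩
  | zero => exact ⟨0, zero_mem _, map_zero _⟩
  | add T S _ _ hT hS =>
    obtain ⟨T, hT, rfl⟩ := hT
    obtain ⟨S, hS, rfl⟩ := hS
    exact ⟨T + S, add_mem hT hS, map_add _ _ _⟩
  | smul c T _ hT =>
    obtain ⟨T, hT, rfl⟩ := hT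
    exact ⟨c • T, Submodule.smul_mem _ _ hT, map_smul _ _ _⟩

/-- Finite rank operators on `X_i` come from finite rank operators on `X`, and `piL i` turns the
`i`-th operator seminorm into the norm on `X_i`. So an approximation on `X_i` is one on `X` for the
single index `i`. -/
theorem exists_finiteRank_opSeminorm_sub_lt (i : ι) {T : H.L} (hT : H.piL i T ∈ (H.level i).K)
    {ε : ℝ≥0∞} (hε : 0 < ε) : ∃ S ∈ H.finiteRank, opSeminorm i (T - S) < ε := by
  have h1 : H.piL i T ∈ @closure _ ((H.level i).opDist PUnit.unit).toUniformSpace.toTopologicalSpace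
      ((H.level i).finiteRank : Set (H.level i).L) := closure.mono (iInf_le _ PUnit.unit) hT
  let _ := (H.level i).opDist PUnit.unit
  obtain ⟨S, hS, hd⟩ := EMetric.mem_closure_iff.1 h1 ε hε
  obtain ⟨S, hS', rfl⟩ := exists_finiteRank_lift i hS
  refine ⟨S, hS', ?_⟩
  rw [← opSeminorm_piL, map_sub]
  exact hd

/-- An operator which is compact on every `X_i` is compact. -/
theorem mem_K_of_piL_mem_K [Preorder ι] [IsDirectedOrder ι] [Nonempty ι] [CompleteSpace H.A]
    (hp : Monotone H.p) {T : H.L} (hT : ∀ i, H.piL i T ∈ (H.level i).K) : T ∈ H.K := by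
  refine mem_closure_iff_nhds.2 fun U hU => ?_
  -- Monotonicity of the operator seminorms makes the neighbourhood filters directed. A
  -- neighbourhood of `T` then contains a ball of a single seminorm, and compactness on that one
  -- `X_i` supplies the approximation.
  have hdir : Directed (· ≥ ·) fun i =>
      @nhds H.L (H.opDist i).toUniformSpace.toTopologicalSpace T := by
    intro i j
    obtain ⟨k, hik, hjk⟩ := exists_ge_ge i j
    have key : ∀ {i k : ι}, i ≤ k → @nhds H.L (H.opDist k).toUniformSpace.toTopologicalSpace T ≤
        @nhds H.L (H.opDist i).toUniformSpace.toTopologicalSpace T := by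
      intro i k hik V hV
      obtain ⟨ε, hε, hV⟩ := (@EMetric.mem_nhds_iff _ (H.opDist i) _ _).1 hV
      refine (@EMetric.mem_nhds_iff _ (H.opDist k) _ _).2 ⟨ε, hε, fun S hS => hV ?_⟩
      exact (opSeminorm_mono (hp hik) (S - T)).trans_lt hS
    exact ⟨k, key hik, key hjk⟩
  rw [nhds_iInf, Filter.mem_iInf_of_directed hdir] at hU
  obtain ⟨i, hU⟩ := hU
  obtain ⟨ε, hε, hU⟩ := (@EMetric.mem_nhds_iff _ (H.opDist i) _ _).1 hU
  obtain ⟨S, hS, hd⟩ := exists_finiteRank_opSeminorm_sub_lt i (hT i) hε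
  refine ⟨S, hU ?_, hS⟩
  change opSeminorm i (S - T) < ε
  rwa [← opSeminorm_neg, neg_sub]

end Levels

end PreHilbertPair

/-! ### The induced actions `φ_l` and the inverse limit -/

open PreHilbertPair

/-- For a directed family no finite intersections are needed: the filters of the individual
seminorms are directed, so one of them already contains `U`. -/
theorem nhds_iInf_seminorm_mem_iff {ι E : Type*} [Preorder ι] [IsDirectedOrder ι] [Nonempty ι]
    [AddCommGroup E] [Module ℂ E] {p : ι → Seminorm ℂ E} (hp : Monotone p) {U : Set E}
    (hU : U ∈ @nhds E (⨅ i, seminormUniformSpace (p i)).toTopologicalSpace 0) :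
    ∃ i, ∃ δ > 0, ∀ x, p i x < δ → x ∈ U := by
  have hdir : Directed (· ≥ ·) fun i => @nhds E (seminormUniformSpace (p i)).toTopologicalSpace 0 := by
    intro i j
    obtain ⟨k, hik, hjk⟩ := exists_ge_ge i j
    have key : ∀ {i k : ι}, i ≤ k → @nhds E (seminormUniformSpace (p k)).toTopologicalSpace 0 ≤
        @nhds E (seminormUniformSpace (p i)).toTopologicalSpace 0 := fun {i k} hik =>
      nhds_mono <| continuous_id_iff_le.1 <|
        continuous_of_seminorm_le (AddMonoidHom.id E) (hp hik)
    exact ⟨k, key hik, key hjk⟩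
  rw [UniformSpace.toTopologicalSpace_iInf, nhds_iInf, Filter.mem_iInf_of_directed hdir] at hU
  obtain ⟨i, hU⟩ := hU
  let _ := (p i).toAddGroupSeminorm.toSeminormedAddCommGroup
  obtain ⟨δ, hδ, hU⟩ := Metric.mem_nhds_iff.1 hU
  refine ⟨i, δ, hδ, fun x hx => hU ?_⟩
  rw [mem_ball_zero_iff]
  exact hx

namespace PreCorrespondence

theorem exists_bound_φ (C : PreCorrespondence.{0, u, v} PUnit) {δ : ℝ} (hδ : 0 < δ)
    (h : ∀ a, C.H.p PUnit.unit a < δ → opSeminorm PUnit.unit (C.φ a) ≤ 1) :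
    ∃ M : ℝ≥0, ∀ a, opSeminorm PUnit.unit (C.φ a) ≤
      M * ENNReal.ofReal (C.H.p PUnit.unit a) := by
  refine ⟨(2 / δ).toNNReal, fun a => ?_⟩
  rcases (apply_nonneg (C.H.p PUnit.unit) a).eq_or_lt with h0 | h0
  · rw [C.H.p_separating a fun _ => h0.symm, map_zero, opSeminorm_zero]
    exact zero_le
  · set P := C.H.p PUnit.unit a
    have hr : 0 < δ / (2 * P) := by positivity
    -- The scaling brings `a` to length `δ / 2`, inside the ball where `h` applies; undoing it gives
    -- the constant `2 / δ`.
    set c : ℂ := ((δ / (2 * P) : ℝ) : ℂ) with hc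
    have hcn : ‖c‖ = δ / (2 * P) := by
      rw [hc, Complex.norm_real, Real.norm_eq_abs, abs_of_pos hr]
    have h2 := h (c • a) (by
      rw [map_smul_eq_mul, hcn]
      have : δ / (2 * P) * P = δ / 2 := by field_simp
      exact this.trans_lt (by linarith))
    have hc0 : c ≠ 0 := norm_ne_zero_iff.1 (hcn ▸ hr.ne')
    have e : C.φ a = c⁻¹ • C.φ (c • a) := by rw [map_smul, inv_smul_smul₀ hc0]
    rw [e]
    refine (opSeminorm_smul_le _ _ _).trans ((mul_le_mul_right h2 _).trans ?_)
    rw [mul_one, ← ENNReal.ofReal_coe_nnreal, coe_nnnorm, norm_inv, hcn,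
      show ((2 / δ).toNNReal : ℝ≥0∞) = ENNReal.ofReal (2 / δ) from rfl,
      ← ENNReal.ofReal_mul (by positivity)]
    refine ENNReal.ofReal_le_ofReal (le_of_eq ?_)
    field_simp

theorem continuous_φ_of_bound (C : PreCorrespondence.{0, u, v} PUnit) {M : ℝ≥0}
    (h : ∀ a, opSeminorm PUnit.unit (C.φ a) ≤ M * ENNReal.ofReal (C.H.p PUnit.unit a)) :
    Continuous C.φ := by
  rw [PreHilbertPair.topologyA_eq]
  refine continuous_iInf_rng.2 fun i => ?_
  let _ : SeminormedAddCommGroup C.H.A :=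
    (C.H.p PUnit.unit).toAddGroupSeminorm.toSeminormedAddCommGroup
  let _ := C.H.opDist i
  refine LipschitzWith.continuous (K := M) fun a b => ?_
  rw [edist_dist, dist_eq_norm]
  change opSeminorm i (C.φ a - C.φ b) ≤ M * ENNReal.ofReal (C.H.p PUnit.unit (a - b))
  rw [← map_sub]
  exact h _

theorem level_φ_piA {ι : Type w} (E : PreCorrespondence.{w, u, v} ι) {l : ι}
    (h : E.PositivelyInvariant (E.H.kerA l)) (a : E.H.A) :
    (E.level l h).φ (E.H.piA l a) = E.H.piL l (E.φ a) := levelFun_piA h a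

/-- Since `φ_l ∘ π_l` is the action of `A` on `X_l` and `π_l` is surjective, `J_X^l` is exactly the
preimage of Katsura's ideal of `X_l`. -/
theorem piA_mem_katsuraIdeal_iff {ι : Type w} (E : PreCorrespondence.{w, u, v} ι) {l : ι}
    (h : E.PositivelyInvariant (E.H.kerA l)) {a : E.H.A} :
    E.H.piA l a ∈ (E.level l h).katsuraIdeal ↔ a ∈ E.levelIdeal l := by
  change (((E.level l h).φ (E.H.piA l a)) ∈ (E.H.level l).K ∧ ∀ b : (E.H.level l).A,
    (E.level l h).φ b = 0 → E.H.piA l a * b = 0) ↔ _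
  rw [level_φ_piA, (E.H.piA_surjective l).forall]
  simp only [level_φ_piA, ← map_mul]
  rfl

end PreCorrespondence

namespace ProCStarCorrespondence

open PreCorrespondence

variable {Λ : Type w} [Preorder Λ] [IsDirectedOrder Λ] [Nonempty Λ]
  (E : ProCStarCorrespondence.{w, u, v} Λ)

/-- Continuity of `φ` yields an index `i`, in general different from `l`, such that smallness of `p
i` bounds the `l`-th operator seminorm. Replacing `a` by a bounded lift of its class in `A_l` turns
this into a bound by `p l` alone. -/
theorem exists_bound_level_φ {l : Λ} (h : E.PositivelyInvariant (E.H.kerA l)) :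
    ∃ M : ℝ≥0, ∀ a, opSeminorm PUnit.unit ((E.level l h).φ a) ≤
      M * ENNReal.ofReal ((E.level l h).H.p PUnit.unit a) := by
  have := E.completeSpace_A
  have hc := continuous_iInf_rng.1 E.continuous_φ l
  have hV : {T : E.H.L | opSeminorm l (T - 0) < 1} ∈
      @nhds E.H.L (E.H.opDist l).toUniformSpace.toTopologicalSpace (E.φ 0) := by
    rw [map_zero]
    exact (@EMetric.mem_nhds_iff _ (E.H.opDist l) _ _).2 ⟨1, one_pos, fun S hS => hS⟩
  have hU : E.φ ⁻¹' {T : E.H.L | opSeminorm l (T - 0) < 1} ∈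
      @nhds E.H.A (⨅ i, seminormUniformSpace (E.H.p i)).toTopologicalSpace 0 :=
    (@Continuous.tendsto _ _ _ (E.H.opDist l).toUniformSpace.toTopologicalSpace _ hc 0) hV
  obtain ⟨i, δ, hδ, hU⟩ := nhds_iInf_seminorm_mem_iff E.p_mono hU
  -- The radius is halved to absorb the factor `2` of `exists_bounded_lift_A`.
  refine exists_bound_φ _ (half_pos hδ) ((E.H.piA_surjective l).forall.2 fun a ha => ?_)
  obtain ⟨y, hy, hb⟩ := exists_bounded_lift_A l a
  have e : E.H.piA l a = E.H.piA l y := by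
    rw [eq_comm, ← sub_eq_zero, ← map_sub]
    exact piA_eq_zero.2 hy
  have ha' : E.H.p l a < δ / 2 := ha
  have hlt : opSeminorm l (E.φ y - 0) < 1 := hU y (by linarith [hb i])
  rw [e, level_φ_piA]
  exact (opSeminorm_piL l _).le.trans (by rw [sub_zero] at hlt; exact hlt.le)

theorem isCStarCorrespondence_level {l : Λ} (h : E.PositivelyInvariant (E.H.kerA l)) :
    (E.level l h).IsCStarCorrespondence := by
  have := E.completeSpace_A
  have := E.completeSpace_X
  obtain ⟨M, hM⟩ := E.exists_bound_level_φ h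
  exact ⟨completeSpaceA_level l, completeSpaceX_level l, continuous_φ_of_bound _ hM⟩

theorem opSeminorm_level_φ_ne_top {l : Λ} (h : E.PositivelyInvariant (E.H.kerA l))
    (a : (E.H.level l).A) : opSeminorm PUnit.unit ((E.level l h).φ a) ≠ ∞ := by
  obtain ⟨M, hM⟩ := E.exists_bound_level_φ h
  exact ne_top_of_le_ne_top (ENNReal.mul_ne_top ENNReal.coe_ne_top ENNReal.ofReal_ne_top) (hM a)

theorem isInverseLimit_level (h : ∀ l, E.PositivelyInvariant (E.H.kerA l)) :
    IsInverseLimit E.toPreCorrespondence (fun l => E.level l (h l))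
      (fun _ _ hl => E.H.piTrans (E.p_mono hl)) (fun _ _ hl => E.H.sigmaTrans (E.p_mono hl))
      (fun l => E.H.piA l) (fun l => E.H.sigmaX l) := by
  have := E.completeSpace_A
  have := E.completeSpace_X
  exact
  { isCStarCorrespondence := fun l => E.isCStarCorrespondence_level (h l)
    inverseSystem_A := ⟨fun l => (E.H.piA_surjective l).forall.2 fun _ => rfl,
      fun k j i _ _ => (E.H.piA_surjective i).forall.2 fun _ => rfl⟩
    inverseSystem_X := ⟨fun l => (E.H.sigmaX_surjective l).forall.2 fun _ => rfl,
      fun k j i _ _ => (E.H.sigmaX_surjective i).forall.2 fun _ => rfl⟩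
    continuous_πt := fun m l hl => continuous_piTrans _
    continuous_σt := fun m l hl => continuous_sigmaTrans _
    inner_σt := fun m l hl => inner_sigmaTrans _
    rsmul_σt := fun m l hl => rsmul_sigmaTrans _
    φ_σt := fun m l hl => (E.H.piA_surjective l).forall.2 fun a =>
      (E.H.sigmaX_surjective l).forall.2 fun x =>
        (level_φ _ m (h m) a x).trans
          (congrArg (E.H.sigmaTrans (E.p_mono hl)) (level_φ _ l (h l) a x)).symm
    inner_σ := fun l => inner_sigmaX l
    rsmul_σ := fun l => rsmul_sigmaX l
    φ_σ := fun l => level_φ _ l (h l)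
    isEmbedding_A := isEmbedding_piA
    range_A := range_eq_coherent (F := fun l => (E.H.level l).A)
      (fun l => (E.H.mkA l).toAddMonoidHom) isUniformInducing_piA
      (fun l => mkA_surjective l) (fun m l hl => E.H.piTrans (E.p_mono hl))
      fun m l hl a => rfl
    isEmbedding_X := isEmbedding_sigmaX
    range_X := range_eq_coherent (F := fun l => (E.H.level l).X)
      (fun l => (E.H.mkX l).toAddMonoidHom) isUniformInducing_sigmaX
      (fun l => mkX_surjective l) (fun m l hl => E.H.sigmaTrans (E.p_mono hl))
      fun m l hl a => rfl }

/-! ### Katsura's ideals of the quotients -/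

variable {m l : Λ} (hml : m ≤ l)

theorem transL_level_φ (hm : E.PositivelyInvariant (E.H.kerA m))
    (hl : E.PositivelyInvariant (E.H.kerA l)) (a : (E.H.level l).A) :
    transL (E.p_mono hml) ((E.level l hl).φ a) =
      (E.level m hm).φ (E.H.piTrans (E.p_mono hml) a) := by
  obtain ⟨a, rfl⟩ := E.H.piA_surjective l a
  rw [level_φ_piA, piTrans_piA, level_φ_piA, transL_piL]

/-- Compactness survives because `φ(b)` acts on `X_l` as a bounded operator. Orthogonality survives
because `b * c` acts as zero whenever `c` does. -/
theorem mul_mem_levelIdeal (hl : E.PositivelyInvariant (E.H.kerA l)) {a : E.H.A}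
    (ha : a ∈ E.levelIdeal l) (b : E.H.A) : a * b ∈ E.levelIdeal l := by
  refine ⟨?_, fun c hc => ?_⟩
  · rw [map_mul, map_mul]
    refine K_mul_L ha.1 fun _ => ?_
    rw [← level_φ_piA E.toPreCorrespondence hl]
    exact E.opSeminorm_level_φ_ne_top hl _
  · rw [mul_assoc]
    exact ha.2 _ (by rw [map_mul, map_mul, hc, mul_zero])

include hml in
/-- If all the kernels are invariant, the connecting maps preserve Katsura's ideals. -/
theorem levelIdeal_subset (hm : E.Invariant (E.H.kerA m : Set E.H.A))
    (hl : E.PositivelyInvariant (E.H.kerA l)) : E.levelIdeal l ⊆ E.levelIdeal m := by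
  have := E.completeSpace_A
  intro a ha
  refine ⟨?_, fun b hb => ?_⟩
  · rw [← transL_piL (E.p_mono hml)]
    exact transL_mem_K _ ha.1
  -- Since `b` acts as zero on `X_m`, so does `a * b`; all `⟪y, φ(a b) x⟫` therefore lie in `ker (p
  -- m)`.
  · have hpre : a * b ∈ E.idealPreimage (E.H.kerA m : Set E.H.A) := by
      intro x y
      change E.H.inner y ((E.φ (a * b)).1 x) ∈ E.H.kerA m
      rw [mem_kerA, ← piA_eq_zero, ← inner_sigmaX]
      have : E.H.sigmaX m ((E.φ (a * b)).1 x) = 0 := by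
        rw [← levelOp_sigmaX]
        have h0 : E.H.piL m (E.φ (a * b)) = 0 := by rw [map_mul, map_mul, hb, mul_zero]
        exact congrArg (fun T : (E.H.level m).L => T.1 (E.H.sigmaX m x)) h0
      rw [this, inner_zero_right]
    -- Negative invariance of `ker (p m)` puts the class of `a * b` into `π_m (ker (p m))`, which is
    -- zero.
    obtain ⟨c, hc, hc'⟩ := hm.2 hml ⟨⟨_, E.mul_mem_levelIdeal hl ha b, rfl⟩, ⟨_, hpre, rfl⟩⟩
    rw [← hc']
    exact piA_eq_zero.2 hc

theorem piTrans_mem_katsuraIdeal (hm : E.Invariant (E.H.kerA m : Set E.H.A))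
    (hl : E.PositivelyInvariant (E.H.kerA l)) {a : (E.H.level l).A}
    (ha : a ∈ (E.level l hl).katsuraIdeal) :
    E.H.piTrans (E.p_mono hml) a ∈ (E.level m hm.1).katsuraIdeal := by
  obtain ⟨a, rfl⟩ := E.H.piA_surjective l a
  rw [piTrans_piA, piA_mem_katsuraIdeal_iff]
  exact E.levelIdeal_subset hml hm hl ((piA_mem_katsuraIdeal_iff _ _).1 ha)

end ProCStarCorrespondence

/-- If `x > y > 0`, the powers of `x / y` would be unbounded, whereas those with exponent `2 ^ n`
are at most `M`. -/
theorem le_of_forall_pow_le_mul_pow {x y M : ℝ} (hy : 0 ≤ y)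
    (h : ∀ n : ℕ, x ^ (2 ^ n) ≤ M * y ^ (2 ^ n)) : x ≤ y := by
  by_contra! hlt
  rcases hy.eq_or_lt with h0 | h0
  · have := h 0
    rw [← h0] at this hlt
    simp only [pow_zero, pow_one, mul_zero] at this
    linarith
  · obtain ⟨n, hn⟩ := pow_unbounded_of_one_lt M ((one_lt_div h0).2 hlt)
    have h1 : (x / y) ^ n ≤ (x / y) ^ (2 ^ n) :=
      pow_le_pow_right₀ ((one_lt_div h0).2 hlt).le Nat.lt_two_pow_self.le
    have h2 : (x / y) ^ (2 ^ n) ≤ M := by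
      rw [div_pow, div_le_iff₀ (by positivity)]
      exact h n
    linarith

namespace PreHilbertPair

/-! ### `*`-homomorphisms from the compact operators to a `C*`-algebra -/

variable {H : PreHilbertPair.{0, u, v} PUnit}

variable (H) in
/-- The operator norm on `K(X)`. -/
def normK (T : H.K) : ℝ := (opSeminorm PUnit.unit T.1).toReal

theorem ofReal_normK (T : H.K) : ENNReal.ofReal (H.normK T) = opSeminorm PUnit.unit T.1 :=
  ENNReal.ofReal_toReal (opSeminorm_ne_top_of_closure _ T.2)

theorem normK_nonneg (T : H.K) : 0 ≤ H.normK T := ENNReal.toReal_nonneg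

theorem normK_mul_le (T S : H.K) : H.normK (T * S) ≤ H.normK T * H.normK S := by
  have hT := opSeminorm_ne_top_of_closure PUnit.unit T.2
  have hS := opSeminorm_ne_top_of_closure PUnit.unit S.2
  rw [normK, normK, normK, ← ENNReal.toReal_mul]
  exact ENNReal.toReal_mono (ENNReal.mul_ne_top hT hS) (opSeminorm_mul_le _ T.1 S.1 hT)

theorem normK_star_le (T : H.K) : H.normK (star T) ≤ 3 * H.normK T := by
  have hT := opSeminorm_ne_top_of_closure PUnit.unit T.2
  have e : 3 * H.normK T = ((3 : ℝ≥0) * opSeminorm PUnit.unit T.1).toReal := by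
    rw [ENNReal.toReal_mul]; rfl
  rw [e]
  exact ENNReal.toReal_mono (ENNReal.mul_ne_top ENNReal.coe_ne_top hT) (opSeminorm_star_le _ T.1)

theorem topologicalSpaceL_le :
    (topologicalSpaceL : TopologicalSpace H.L) ≤
      (H.opDist PUnit.unit).toUniformSpace.toTopologicalSpace := iInf_le _ PUnit.unit

theorem continuous_of_norm_le_normK {B : Type*} [NonUnitalCStarAlgebra B] (ψ : H.K →⋆ₙₐ[ℂ] B)
    {M : ℝ≥0} (h : ∀ T, ‖ψ T‖ ≤ M * H.normK T) : Continuous ψ := by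
  refine continuous_le_dom (induced_mono topologicalSpaceL_le) ?_
  let _ := H.opDist PUnit.unit
  refine LipschitzWith.continuous (K := M) fun T S => ?_
  rw [edist_dist, dist_eq_norm]
  change _ ≤ (M : ℝ≥0∞) * opSeminorm PUnit.unit (T - S : H.K).1
  rw [← ofReal_normK, ← ENNReal.ofReal_coe_nnreal, ← ENNReal.ofReal_mul M.coe_nonneg, ← map_sub]
  exact ENNReal.ofReal_le_ofReal (h _)

variable {B : Type*} [NonUnitalCStarAlgebra B] {ψ : H.K →⋆ₙₐ[ℂ] B}

theorem exists_norm_le_mul_normK (hψ : Continuous ψ) : ∃ M : ℝ, ∀ T, ‖ψ T‖ ≤ M * H.normK T := by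
  have hU : {T : H.K | ‖ψ T‖ < 1} ∈ 𝓝 (0 : H.K) := by
    refine (isOpen_lt (continuous_norm.comp hψ) continuous_const).mem_nhds ?_
    change ‖ψ 0‖ < 1
    rw [map_zero, norm_zero]
    exact one_pos
  rw [nhds_subtype, Filter.mem_comap] at hU
  obtain ⟨V, hV, hVU⟩ := hU
  have hV' : V ∈ @nhds H.L (H.opDist PUnit.unit).toUniformSpace.toTopologicalSpace 0 := by
    rw [topologicalSpaceL, ciInf_unique] at hV
    exact hV
  obtain ⟨ε, hε, hball⟩ := (@EMetric.mem_nhds_iff _ (H.opDist PUnit.unit) _ _).1 hV'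
  obtain ⟨δ, hδ, hδε⟩ := ENNReal.lt_iff_exists_nnreal_btwn.1 hε
  have hδ0 : (0 : ℝ) < δ := by exact_mod_cast hδ
  have key : ∀ T : H.K, H.normK T < δ → ‖ψ T‖ < 1 := by
    intro T hT
    refine hVU (hball ?_)
    change opSeminorm PUnit.unit (T.1 - 0) < ε
    rw [sub_zero, ← ofReal_normK]
    refine lt_of_lt_of_le ?_ hδε.le
    rw [← ENNReal.ofReal_coe_nnreal]
    exact (ENNReal.ofReal_lt_ofReal_iff hδ0).2 hT
  -- Any `s` strictly above the bound is positive even if `T = 0`, and dividing `T` by `s` brings it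
  -- into the ball of radius `δ`.
  refine ⟨1 / δ, fun T => le_of_forall_gt_imp_ge_of_dense fun s hs => ?_⟩
  have hs0 : 0 < s := lt_of_le_of_lt (mul_nonneg (by positivity) (normK_nonneg T)) hs
  set c : ℂ := ((1 / s : ℝ) : ℂ) with hc
  have hcn : ‖c‖ = 1 / s := by
    rw [hc, Complex.norm_real, Real.norm_eq_abs, abs_of_pos (by positivity)]
  set cT : H.K := ⟨c • T.1, SMulMemClass.smul_mem c T.2⟩
  have h1 : H.normK cT ≤ (1 / s) * H.normK T := by
    have hT := opSeminorm_ne_top_of_closure PUnit.unit T.2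
    have := ENNReal.toReal_mono (ENNReal.mul_ne_top ENNReal.coe_ne_top hT)
      (opSeminorm_smul_le PUnit.unit c T.1)
    rw [ENNReal.toReal_mul, ENNReal.coe_toReal, coe_nnnorm, hcn] at this
    exact this
  have h2 := key cT (h1.trans_lt (by
    rw [one_div_mul_eq_div, div_lt_iff₀ hs0]
    rw [one_div_mul_eq_div, div_lt_iff₀ hδ0] at hs
    linarith))
  rw [show ψ cT = c • ψ T from ψ.map_smul' c T, norm_smul, hcn, one_div_mul_eq_div,
    div_lt_one hs0] at h2
  exact h2.le

/-- By repeated squaring, the norm of `ψ S` to the power `2 ^ n` is the norm of `ψ` at that power of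
`S`. The constant from continuity enters only once and disappears in the limit. -/
theorem norm_le_normK_of_isSelfAdjoint (hψ : Continuous ψ) {S : H.K} (hS : star S = S) :
    ‖ψ S‖ ≤ H.normK S := by
  obtain ⟨M, hM⟩ := exists_norm_le_mul_normK hψ
  have hM' : ∀ T, ‖ψ T‖ ≤ max M 0 * H.normK T := fun T =>
    (hM T).trans (mul_le_mul_of_nonneg_right (le_max_left _ _) (normK_nonneg T))
  refine le_of_forall_pow_le_mul_pow (M := max M 0) (normK_nonneg S) fun n => ?_
  induction n generalizing S with
  | zero => simpa using hM' S
  | succ n ih =>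
    have h1 := ih (S := S * S) (by rw [star_mul, hS])
    have h2 : ‖ψ (S * S)‖ = ‖ψ S‖ ^ 2 := by
      have : ψ (S * S) = star (ψ S) * ψ S := by rw [← map_star, hS, map_mul]
      rw [this, CStarRing.norm_star_mul_self, pow_two]
    rw [h2, ← pow_mul, ← pow_succ'] at h1
    refine h1.trans (mul_le_mul_of_nonneg_left ?_ (le_max_right _ _))
    rw [pow_succ', pow_mul]
    refine pow_le_pow_left₀ (normK_nonneg _) ?_ _
    rw [pow_two]
    exact normK_mul_le S S

/-- The self-adjoint case for `star T * T` and the crude bound `normK (star T) ≤ 3 * normK T` give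
the constant `√3 ≤ 2`. What matters is that it does not depend on `ψ`: the product of all chosen `ψ`
is then bounded and lands in the `ℓ^∞`-product. -/
theorem norm_le_normK (hψ : Continuous ψ) (T : H.K) : ‖ψ T‖ ≤ 2 * H.normK T := by
  have h1 := norm_le_normK_of_isSelfAdjoint hψ (S := star T * T) (by rw [star_mul, star_star])
  rw [map_mul, map_star, CStarRing.norm_star_mul_self] at h1
  have h2 := (normK_mul_le (star T) T).trans
    (mul_le_mul_of_nonneg_right (normK_star_le T) (normK_nonneg T))
  nlinarith [norm_nonneg (ψ T), normK_nonneg T]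

end PreHilbertPair

/-! ### The universal property of `O_X` -/

namespace PreCorrespondence

variable (C : PreCorrespondence.{0, u, v} PUnit)

/-- The `*`-homomorphism `ψ` of a chosen covariant representation. -/
def chosenψ (N : Set.range (CovariantRep.polyNorm (C := C))) : C.H.K →⋆ₙₐ[ℂ] (C.chosenRep N).B :=
  (C.chosenRep N).covariant.choose

theorem continuous_chosenψ (N : Set.range (CovariantRep.polyNorm (C := C))) :
    Continuous (C.chosenψ N) := (C.chosenRep N).covariant.choose_spec.1

/-- The product of the `*`-homomorphisms `ψ` of the chosen covariant representations. -/
def ambientψ : C.H.K →⋆ₙₐ[ℂ] C.Ambient where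
  toFun T := ⟨fun N => C.chosenψ N T, memℓp_infty ⟨2 * C.H.normK T, by
    rintro _ ⟨N, rfl⟩
    exact norm_le_normK (C.continuous_chosenψ N) T⟩⟩
  map_smul' c T := by ext N; exact (C.chosenψ N).map_smul' c T
  map_zero' := by ext N; exact map_zero (C.chosenψ N)
  map_add' S T := by ext N; exact map_add (C.chosenψ N) S T
  map_mul' S T := by ext N; exact map_mul (C.chosenψ N) S T
  map_star' T := by ext N; exact map_star (C.chosenψ N) T

theorem continuous_ambientψ : Continuous C.ambientψ :=
  continuous_of_norm_le_normK (M := 2) _ fun T =>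
    lp.norm_le_of_forall_le (mul_nonneg zero_le_two (normK_nonneg T))
      fun N => norm_le_normK (C.continuous_chosenψ N) T

theorem ambientψ_theta (x y : C.H.X) :
    C.ambientψ ⟨theta x y, theta_mem_K x y⟩ = C.ambientT x * star (C.ambientT y) := by
  ext N
  exact (C.chosenRep N).covariant.choose_spec.2.1 x y

theorem ambientT_mem (x : C.H.X) : C.ambientT x ∈ C.cuntzPimsner :=
  (C.canonicalRep.t x).2

theorem ambientψ_mem (T : C.H.K) : C.ambientψ T ∈ C.cuntzPimsner :=
  map_K_mem C.continuous_ambientψ _ (NonUnitalStarSubalgebra.isClosed_topologicalClosure _)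
    (fun y x => by
      rw [ambientψ_theta]
      exact mul_mem (C.ambientT_mem y) (star_mem (C.ambientT_mem x))) T

theorem canonicalRep_covariant : C.canonicalRep.IsCovariantOn C.katsuraIdeal := by
  refine ⟨NonUnitalStarAlgHom.codRestrict C.ambientψ C.cuntzPimsner C.ambientψ_mem,
    C.continuous_ambientψ.subtype_mk _, fun x y => Subtype.ext (C.ambientψ_theta x y),
    fun a ha => ⟨ha.1, Subtype.ext ?_⟩⟩
  ext N
  obtain ⟨_, h⟩ := (C.chosenRep N).covariant.choose_spec.2.2 a ha
  exact h

/-- `O_X` is a closure taken in the ambient product, while density is asserted inside `O_X`. The two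
match because a closure in a subspace is the trace of the ambient closure, and the generators
correspond. -/
theorem canonicalRep_generates :
    (NonUnitalStarAlgebra.adjoin ℂ
      (Set.range C.canonicalRep.π ∪ Set.range C.canonicalRep.t)).topologicalClosure = ⊤ := by
  rw [eq_top_iff]
  intro x _
  change x ∈ closure ((NonUnitalStarAlgebra.adjoin ℂ
    (Set.range C.canonicalRep.π ∪ Set.range C.canonicalRep.t) : NonUnitalStarSubalgebra ℂ C.O) :
      Set C.O)
  rw [closure_subtype]
  refine closure_mono ?_ x.2
  have : NonUnitalStarAlgebra.adjoin ℂ (Set.range C.ambientπ ∪ Set.range C.ambientT) ≤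
      (NonUnitalStarAlgebra.adjoin ℂ (Set.range C.canonicalRep.π ∪
        Set.range C.canonicalRep.t)).map (NonUnitalStarSubalgebraClass.subtype C.cuntzPimsner) := by
    refine NonUnitalStarAlgebra.adjoin_le ?_
    rintro _ (⟨a, rfl⟩ | ⟨y, rfl⟩)
    · exact ⟨C.canonicalRep.π a, NonUnitalStarAlgebra.subset_adjoin _ _ (Or.inl ⟨a, rfl⟩), rfl⟩
    · exact ⟨C.canonicalRep.t y, NonUnitalStarAlgebra.subset_adjoin _ _ (Or.inr ⟨y, rfl⟩), rfl⟩
  exact this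

end PreCorrespondence

theorem continuous_starAlgHom {B D : Type*} [NonUnitalCStarAlgebra B] [NonUnitalCStarAlgebra D]
    (Φ : B →⋆ₙₐ[ℂ] D) : Continuous Φ :=
  AddMonoidHomClass.continuous_of_bound Φ 1 fun b => by
    rw [one_mul]; exact NonUnitalStarAlgHom.norm_apply_le Φ b

/-- The equalizer of two homomorphisms is a closed `*`-subalgebra, as they are automatically
continuous, and it contains the generators. -/
theorem Representation.hom_ext_of_generates {C : PreCorrespondence.{0, u, v} PUnit} {B D : Type*}
    [NonUnitalCStarAlgebra B] [NonUnitalCStarAlgebra D] {R : Representation C B}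
    (hR : (NonUnitalStarAlgebra.adjoin ℂ (Set.range R.π ∪ Set.range R.t)).topologicalClosure = ⊤)
    {Φ Ψ : B →⋆ₙₐ[ℂ] D} (hπ : ∀ a, Φ (R.π a) = Ψ (R.π a)) (ht : ∀ x, Φ (R.t x) = Ψ (R.t x)) :
    Φ = Ψ := by
  have hc : IsClosed (NonUnitalStarAlgHom.equalizer Φ Ψ : Set B) :=
    isClosed_eq (continuous_starAlgHom Φ) (continuous_starAlgHom Ψ)
  have : NonUnitalStarAlgebra.adjoin ℂ (Set.range R.π ∪ Set.range R.t) ≤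
      NonUnitalStarAlgHom.equalizer Φ Ψ := by
    refine NonUnitalStarAlgebra.adjoin_le ?_
    rintro _ (⟨a, rfl⟩ | ⟨x, rfl⟩)
    · exact hπ a
    · exact ht x
  have h := NonUnitalStarSubalgebra.topologicalClosure_minimal _ this hc
  rw [hR] at h
  exact DFunLike.ext _ _ fun b => h NonUnitalStarAlgebra.mem_top

namespace PreCorrespondence

variable (C : PreCorrespondence.{0, u, v} PUnit)

/-- The evaluation of polynomials in the product of the chosen representations. -/
def ambientEval : C.Poly →ₙₐ[ℂ] C.Ambient :=
  FreeNonUnitalNonAssocAlgebra.lift ℂ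
    (Sum.elim C.ambientπ (Sum.elim C.ambientT fun x => star (C.ambientT x)))

/-- The evaluation of polynomials in a representation. -/
def repEval {C : PreCorrespondence.{0, u, v} PUnit} {D : Type*} [NonUnitalCStarAlgebra D]
    (S : Representation C D) : C.Poly →ₙₐ[ℂ] D :=
  FreeNonUnitalNonAssocAlgebra.lift ℂ (Sum.elim S.π (Sum.elim S.t fun x => star (S.t x)))

theorem ambientEval_apply (f : C.Poly) (N : Set.range (CovariantRep.polyNorm (C := C))) :
    (C.ambientEval f).1 N = repEval (C.chosenRep N).R f := by
  let ev : C.Ambient →ₙₐ[ℂ] (C.chosenRep N).B :=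
    { toFun := fun g => g.1 N
      map_smul' := fun _ _ => rfl
      map_zero' := rfl
      map_add' := fun _ _ => rfl
      map_mul' := fun _ _ => rfl }
  have : ev.comp C.ambientEval = repEval (C.chosenRep N).R := by
    refine FreeNonUnitalNonAssocAlgebra.hom_ext ℂ ?_
    intro s
    change (C.ambientEval (FreeNonUnitalNonAssocAlgebra.of ℂ s)).1 N =
      repEval _ (FreeNonUnitalNonAssocAlgebra.of ℂ s)
    rw [ambientEval, repEval, FreeNonUnitalNonAssocAlgebra.lift_of_apply,
      FreeNonUnitalNonAssocAlgebra.lift_of_apply]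
    rcases s with a | x | x <;> rfl
  exact DFunLike.congr_fun this f

variable {C} {D : Type max u v} [NonUnitalCStarAlgebra D] {S : Representation C D}

/-- The norm function of `S` on polynomials is realised by one of the chosen representations, which
is a coordinate of the ambient product. Choosing one representation per norm function thus loses
nothing. -/
theorem norm_repEval_le (hS : S.IsCovariantOn C.katsuraIdeal) (f : C.Poly) :
    ‖repEval S f‖ ≤ ‖C.ambientEval f‖ := by
  let R : C.CovariantRep := ⟨D, S, hS⟩
  let N : Set.range (CovariantRep.polyNorm (C := C)) := ⟨R.polyNorm, R, rfl⟩
  have h : (C.chosenRep N).polyNorm = R.polyNorm := N.2.choose_spec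
  calc ‖repEval S f‖ = (C.chosenRep N).polyNorm f := (congrFun h f).symm
    _ = ‖(C.ambientEval f).1 N‖ := by rw [ambientEval_apply]; rfl
    _ ≤ _ := lp.norm_apply_le_norm ENNReal.top_ne_zero _ _

variable (S) in
/-- The closure of the graph of the map `O_X → D` induced by a representation on `D`. -/
def graphAlgebra : NonUnitalStarSubalgebra ℂ (C.Ambient × D) :=
  (NonUnitalStarAlgebra.adjoin ℂ
    (Set.range (fun a => (C.ambientπ a, S.π a)) ∪
      Set.range fun x => (C.ambientT x, S.t x))).topologicalClosure

theorem π_mem_graphAlgebra (a : C.H.A) : (C.ambientπ a, S.π a) ∈ graphAlgebra S :=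
  NonUnitalStarSubalgebra.le_topologicalClosure _
    (NonUnitalStarAlgebra.subset_adjoin _ _ (Or.inl ⟨a, rfl⟩))

theorem t_mem_graphAlgebra (x : C.H.X) : (C.ambientT x, S.t x) ∈ graphAlgebra S :=
  NonUnitalStarSubalgebra.le_topologicalClosure _
    (NonUnitalStarAlgebra.subset_adjoin _ _ (Or.inr ⟨x, rfl⟩))

instance isClosed_graphAlgebra : IsClosed (graphAlgebra S : Set (C.Ambient × D)) :=
  NonUnitalStarSubalgebra.isClosed_topologicalClosure _

/-- The generated `*`-algebra is the algebra generated by the generators and their adjoints.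
Adjoints of elements of `A` come from `A` again, and those of elements of `X` have symbols of their
own, so every element is the value of a polynomial. -/
theorem exists_poly_of_mem_adjoin {g : C.Ambient × D}
    (hg : g ∈ NonUnitalStarAlgebra.adjoin ℂ
      (Set.range (fun a => (C.ambientπ a, S.π a)) ∪ Set.range fun x => (C.ambientT x, S.t x))) :
    ∃ f : C.Poly, (C.ambientEval f, repEval S f) = g := by
  have hle : NonUnitalAlgebra.adjoin ℂ
      ((Set.range (fun a => (C.ambientπ a, S.π a)) ∪ Set.range fun x => (C.ambientT x, S.t x)) ∪
        star (Set.range (fun a => (C.ambientπ a, S.π a)) ∪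
          Set.range fun x => (C.ambientT x, S.t x))) ≤
      NonUnitalAlgHom.range (NonUnitalAlgHom.prod C.ambientEval (repEval S)) := by
    have hof : ∀ s, (NonUnitalAlgHom.prod C.ambientEval (repEval S)) (FreeNonUnitalNonAssocAlgebra.of ℂ s) =
        (Sum.elim C.ambientπ (Sum.elim C.ambientT fun x => star (C.ambientT x)) s,
          Sum.elim S.π (Sum.elim S.t fun x => star (S.t x)) s) := fun s => by
      change (C.ambientEval _, repEval S _) = _
      rw [ambientEval, repEval, FreeNonUnitalNonAssocAlgebra.lift_of_apply,
        FreeNonUnitalNonAssocAlgebra.lift_of_apply]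
    refine NonUnitalAlgebra.adjoin_le ?_
    rintro g ((⟨a, rfl⟩ | ⟨x, rfl⟩) | (⟨a, ha⟩ | ⟨x, hx⟩))
    · exact ⟨_, hof (Sum.inl a)⟩
    · exact ⟨_, hof (Sum.inr (Sum.inl x))⟩
    · refine ⟨_, (hof (Sum.inl (star a))).trans ?_⟩
      rw [← star_star g, ← ha]
      exact Prod.ext (map_star C.ambientπ a) (map_star S.π a)
    · refine ⟨_, (hof (Sum.inr (Sum.inr x))).trans ?_⟩
      rw [← star_star g, ← hx]
      rfl
  obtain ⟨f, hf⟩ := hle hg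
  exact ⟨f, hf⟩

/-- The inequality holds for values of polynomials and is a closed condition. It says that the graph
is that of a contractive map. -/
theorem norm_snd_le_of_mem_graphAlgebra (hS : S.IsCovariantOn C.katsuraIdeal)
    {g : C.Ambient × D} (hg : g ∈ graphAlgebra S) : ‖g.2‖ ≤ ‖g.1‖ := by
  refine closure_minimal (t := {g : C.Ambient × D | ‖g.2‖ ≤ ‖g.1‖}) ?_
    (isClosed_le (by fun_prop) (by fun_prop)) hg
  intro g hg
  obtain ⟨f, rfl⟩ := exists_poly_of_mem_adjoin hg
  exact norm_repEval_le hS f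

theorem fst_mem_of_mem_graphAlgebra {g : C.Ambient × D} (hg : g ∈ graphAlgebra S) :
    g.1 ∈ C.cuntzPimsner := by
  have hle : NonUnitalStarAlgebra.adjoin ℂ (Set.range (fun a => (C.ambientπ a, S.π a)) ∪
      Set.range fun x => (C.ambientT x, S.t x)) ≤
      C.cuntzPimsner.comap (NonUnitalStarAlgHom.fst ℂ C.Ambient D) := by
    refine NonUnitalStarAlgebra.adjoin_le ?_
    rintro _ (⟨a, rfl⟩ | ⟨x, rfl⟩)
    · exact (C.canonicalRep.π a).2
    · exact (C.canonicalRep.t x).2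
  exact NonUnitalStarSubalgebra.topologicalClosure_minimal _ hle
    ((isClosed_cuntzPimsner C).preimage continuous_fst) hg

variable (S) in
/-- The projection of the graph to `O_X`. -/
def graphFst : graphAlgebra S →⋆ₙₐ[ℂ] C.O :=
  NonUnitalStarAlgHom.codRestrict ((NonUnitalStarAlgHom.fst ℂ C.Ambient D).comp
    (NonUnitalStarSubalgebraClass.subtype (graphAlgebra S))) C.cuntzPimsner
    fun g => fst_mem_of_mem_graphAlgebra g.2

/-- The norm inequality forces injectivity. An injective `*`-homomorphism of `C*`-algebras is
isometric, so its range is closed, and it contains the generators of `O_X`. -/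
theorem graphFst_bijective (hS : S.IsCovariantOn C.katsuraIdeal) :
    Function.Bijective (graphFst S) := by
  have hinj : Function.Injective (graphFst S) := by
    refine (injective_iff_map_eq_zero (graphFst S)).2 fun g hg => Subtype.ext ?_
    have h1 : g.1.1 = 0 := congrArg Subtype.val hg
    have h2 := norm_snd_le_of_mem_graphAlgebra hS g.2
    rw [h1, norm_zero] at h2
    exact Prod.ext h1 (norm_le_zero_iff.1 h2)
  refine ⟨hinj, fun b => ?_⟩
  have hcl : IsClosed (NonUnitalStarAlgHom.range (graphFst S) : Set C.O) :=
    (NonUnitalStarAlgHom.isometry (graphFst S) hinj).isUniformInducing.isComplete_range.isClosed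
  have hle : NonUnitalStarAlgebra.adjoin ℂ
      (Set.range C.canonicalRep.π ∪ Set.range C.canonicalRep.t) ≤
      NonUnitalStarAlgHom.range (graphFst S) := by
    refine NonUnitalStarAlgebra.adjoin_le ?_
    rintro _ (⟨a, rfl⟩ | ⟨x, rfl⟩)
    · exact ⟨⟨_, π_mem_graphAlgebra a⟩, rfl⟩
    · exact ⟨⟨_, t_mem_graphAlgebra x⟩, rfl⟩
  have h := NonUnitalStarSubalgebra.topologicalClosure_minimal _ hle hcl
  rw [C.canonicalRep_generates] at h
  exact h NonUnitalStarAlgebra.mem_top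

/-- The map is the inverse of the projection of the graph to `O_X`, followed by the projection to
`D`. -/
theorem exists_hom_of_isCovariantOn (hS : S.IsCovariantOn C.katsuraIdeal) :
    ∃ Φ : C.O →⋆ₙₐ[ℂ] D,
      (∀ a, Φ (C.canonicalRep.π a) = S.π a) ∧ ∀ x, Φ (C.canonicalRep.t x) = S.t x := by
  let e := StarAlgEquiv.ofBijective (graphFst S) (graphFst_bijective hS)
  have he : ∀ g, e.symm (graphFst S g) = g := fun g => e.symm_apply_apply g
  let Φ : C.O →⋆ₙₐ[ℂ] D := ((NonUnitalStarAlgHom.snd ℂ C.Ambient D).comp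
    (NonUnitalStarSubalgebraClass.subtype (graphAlgebra S))).comp
      (e.symm : C.O →⋆ₙₐ[ℂ] graphAlgebra S)
  refine ⟨Φ, fun a => ?_, fun x => ?_⟩
  · exact congrArg (fun g : graphAlgebra S => g.1.2) (he ⟨_, π_mem_graphAlgebra a⟩)
  · exact congrArg (fun g : graphAlgebra S => g.1.2) (he ⟨_, t_mem_graphAlgebra x⟩)

variable (C) in
theorem isUniversal_canonicalRep : C.canonicalRep.IsUniversal where
  covariant := C.canonicalRep_covariant
  generates := C.canonicalRep_generates
  existsUnique D _ S hS := by
    obtain ⟨Φ, hπ, ht⟩ := exists_hom_of_isCovariantOn hS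
    refine ⟨Φ, ⟨hπ, ht⟩, fun Ψ hΨ => ?_⟩
    exact Representation.hom_ext_of_generates C.canonicalRep_generates
      (fun a => (hΨ.1 a).trans (hπ a).symm) fun x => (hΨ.2 x).trans (ht x).symm

end PreCorrespondence

/-! ### The inverse system of the `O_{X_l}` and the representation on its limit -/

open PreCorrespondence

namespace ProCStarCorrespondence

variable {Λ : Type w} [Preorder Λ] [IsDirectedOrder Λ] [Nonempty Λ]
  (E : ProCStarCorrespondence.{w, u, v} Λ)

/-- The representation of `X_l` on `O_{X_m}` through the connecting maps. -/
def transRep {m l : Λ} (hml : m ≤ l) (hm : E.PositivelyInvariant (E.H.kerA m))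
    (hl : E.PositivelyInvariant (E.H.kerA l)) : Representation (E.level l hl) (E.level m hm).O where
  π := (E.level m hm).canonicalRep.π.comp (E.H.piTrans (E.p_mono hml))
  t := fun x => (E.level m hm).canonicalRep.t (E.H.sigmaTrans (E.p_mono hml) x)
  continuous_π := (E.level m hm).canonicalRep.continuous_π.comp
    (continuous_piTrans (E.p_mono hml))
  star_t_mul_t x y := ((E.level m hm).canonicalRep.star_t_mul_t _ _).trans
    (congrArg (E.level m hm).canonicalRep.π (inner_sigmaTrans (E.p_mono hml) x y))
  π_mul_t a x := by
    refine ((E.level m hm).canonicalRep.π_mul_t _ _).trans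
      (congrArg (E.level m hm).canonicalRep.t ?_)
    exact (congrArg (fun T : (E.H.level m).L => T.1 (E.H.sigmaTrans (E.p_mono hml) x))
      (E.transL_level_φ hml hm hl a)).symm.trans (transL_sigmaTrans (E.p_mono hml) _ x)

/-- The required `ψ` is that of `O_{X_m}` composed with the canonical map from `K(X_l)` to `K(X_m)`.
Covariance transfers because the connecting map carries Katsura's ideal of `X_l` into that of `X_m`.
-/
theorem transRep_isCovariantOn {m l : Λ} (hml : m ≤ l)
    (hm : E.Invariant (E.H.kerA m : Set E.H.A)) (hl : E.PositivelyInvariant (E.H.kerA l)) :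
    (E.transRep hml hm.1 hl).IsCovariantOn (E.level l hl).katsuraIdeal := by
  have := E.completeSpace_A
  obtain ⟨ψ, hc, hθ, ha⟩ := (E.level m hm.1).canonicalRep_covariant
  have hK : ∀ T ∈ (E.H.level l).K, transL (E.p_mono hml) T ∈ (E.H.level m).K :=
    fun T hT => transL_mem_K _ hT
  refine ⟨ψ.comp (mapK (transL (E.p_mono hml)) hK),
    hc.comp (continuous_mapK _ hK (continuous_transL _)), fun x y => ?_, fun a haK => ⟨haK.1, ?_⟩⟩
  · refine (congrArg ψ (Subtype.ext ?_)).trans (hθ _ _)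
    exact transL_theta (E.p_mono hml) x y
  · obtain ⟨h, hψ⟩ := ha _ (E.piTrans_mem_katsuraIdeal hml hm hl haK)
    refine (congrArg ψ (Subtype.ext ?_)).trans hψ
    exact E.transL_level_φ hml hm.1 hl a

variable (hE : ∀ l : Λ, E.Invariant (E.H.kerA l : Set E.H.A))

/-- The connecting maps `O_{X_l} → O_{X_m}`. -/
theorem exists_connectingMaps :
    ∃ ρ : ∀ ⦃m l : Λ⦄, m ≤ l → (E.level l (hE l).1).O →⋆ₙₐ[ℂ] (E.level m (hE m).1).O,
      ∀ m l (h : m ≤ l),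
        (∀ a, ρ h ((E.level l (hE l).1).canonicalRep.π a)
          = (E.level m (hE m).1).canonicalRep.π (E.H.piTrans (E.p_mono h) a)) ∧
        (∀ x, ρ h ((E.level l (hE l).1).canonicalRep.t x)
          = (E.level m (hE m).1).canonicalRep.t (E.H.sigmaTrans (E.p_mono h) x)) := by
  choose ρ hρ using fun (m l : Λ) (h : m ≤ l) =>
    exists_hom_of_isCovariantOn (E.transRep_isCovariantOn h (hE m) (hE l).1)
  exact ⟨fun m l h => ρ m l h, hρ⟩

variable {E hE}
  {ρ : ∀ ⦃m l : Λ⦄, m ≤ l → (E.level l (hE l).1).O →⋆ₙₐ[ℂ] (E.level m (hE m).1).O}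

/-- Both laws need checking only on the generators, where they reduce to those for the connecting
maps of `A_l` and `X_l`. -/
theorem inverseSystem_of_generators
    (hπ : ∀ m l (h : m ≤ l) a, ρ h ((E.level l (hE l).1).canonicalRep.π a)
      = (E.level m (hE m).1).canonicalRep.π (E.H.piTrans (E.p_mono h) a))
    (ht : ∀ m l (h : m ≤ l) x, ρ h ((E.level l (hE l).1).canonicalRep.t x)
      = (E.level m (hE m).1).canonicalRep.t (E.H.sigmaTrans (E.p_mono h) x)) :
    InverseSystem fun _ _ h => ρ h := by
  refine ⟨fun l b => ?_, fun k j i hkj hji b => ?_⟩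
  · have : ρ (le_refl l) = NonUnitalStarAlgHom.id ℂ _ :=
      Representation.hom_ext_of_generates (canonicalRep_generates _)
        ((E.H.piA_surjective l).forall.2 fun a => hπ l l le_rfl _)
        ((E.H.sigmaX_surjective l).forall.2 fun x => ht l l le_rfl _)
    exact DFunLike.congr_fun this b
  · have : (ρ hkj).comp (ρ hji) = ρ (hkj.trans hji) := by
      refine Representation.hom_ext_of_generates (canonicalRep_generates _)
        ((E.H.piA_surjective i).forall.2 fun a => ?_)
        ((E.H.sigmaX_surjective i).forall.2 fun x => ?_)
      · rw [NonUnitalStarAlgHom.comp_apply]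
        exact ((congrArg (ρ hkj) (hπ j i hji _)).trans (hπ k j hkj _)).trans
          (hπ k i (hkj.trans hji) (E.H.piA i a)).symm
      · rw [NonUnitalStarAlgHom.comp_apply]
        exact ((congrArg (ρ hkj) (ht j i hji _)).trans (ht k j hkj _)).trans
          (ht k i (hkj.trans hji) (E.H.sigmaX i x)).symm
    exact DFunLike.congr_fun this b

theorem continuous_piA (l : Λ) : Continuous (E.H.piA l) :=
  continuous_pi_iff.1 isEmbedding_piA.continuous l

variable
    (hπ : ∀ m l (h : m ≤ l) a, ρ h ((E.level l (hE l).1).canonicalRep.π a)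
      = (E.level m (hE m).1).canonicalRep.π (E.H.piTrans (E.p_mono h) a))
    (ht : ∀ m l (h : m ≤ l) x, ρ h ((E.level l (hE l).1).canonicalRep.t x)
      = (E.level m (hE m).1).canonicalRep.t (E.H.sigmaTrans (E.p_mono h) x))

/-- The representation of `X` on the inverse limit of the algebras `O_{X_l}`. -/
def limitRep : Representation E.toPreCorrespondence (limitAlgebra ρ) where
  π :=
    { toFun := fun a => ⟨fun l => (E.level l (hE l).1).canonicalRep.π (E.H.piA l a),
        fun m l h => hπ m l h (E.H.piA l a)⟩
      map_smul' := fun c a => Subtype.ext <| funext fun l =>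
        map_smul ((E.level l (hE l).1).canonicalRep.π.comp (E.H.piA l)) c a
      map_zero' := Subtype.ext <| funext fun l =>
        map_zero ((E.level l (hE l).1).canonicalRep.π.comp (E.H.piA l))
      map_add' := fun a b => Subtype.ext <| funext fun l =>
        map_add ((E.level l (hE l).1).canonicalRep.π.comp (E.H.piA l)) a b
      map_mul' := fun a b => Subtype.ext <| funext fun l =>
        map_mul ((E.level l (hE l).1).canonicalRep.π.comp (E.H.piA l)) a b
      map_star' := fun a => Subtype.ext <| funext fun l =>
        map_star ((E.level l (hE l).1).canonicalRep.π.comp (E.H.piA l)) a }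
  t := fun x => ⟨fun l => (E.level l (hE l).1).canonicalRep.t (E.H.sigmaX l x),
    fun m l h => ht m l h (E.H.sigmaX l x)⟩
  continuous_π := Continuous.subtype_mk (continuous_pi fun l =>
    (E.level l (hE l).1).canonicalRep.continuous_π.comp (continuous_piA l)) _
  star_t_mul_t _ _ := Subtype.ext <| funext fun l =>
    (E.level l (hE l).1).canonicalRep.star_t_mul_t _ _
  π_mul_t a x := Subtype.ext <| funext fun l =>
    ((E.level l (hE l).1).canonicalRep.π_mul_t _ _).trans
      (congrArg (E.level l (hE l).1).canonicalRep.t (level_φ _ l (hE l).1 a x))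

set_option synthInstance.maxHeartbeats 200000 in
set_option maxHeartbeats 1000000 in
theorem limitRep_isCovariantOn :
    (limitRep (hE := hE) (ρ := ρ) hπ ht).IsCovariantOn (B := limitAlgebra ρ) E.covarianceIdeal := by
  have := E.completeSpace_A
  choose ψ hc hθ ha using fun l => (E.level l (hE l).1).canonicalRep_covariant
  have hK : ∀ l, ∀ T ∈ E.H.K, E.H.piL l T ∈ (E.H.level l).K := fun l T hT => piL_mem_K l hT
  have hcont : ∀ l, Continuous ((ψ l).comp (mapK (E.H.piL l) (hK l))) := fun l =>
    (hc l).comp (continuous_mapK _ (hK l) (continuous_piL l))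
  have hθ' : ∀ l x y, (ψ l).comp (mapK (E.H.piL l) (hK l)) ⟨theta x y, theta_mem_K x y⟩ =
      (E.level l (hE l).1).canonicalRep.t (E.H.sigmaX l x) *
        star ((E.level l (hE l).1).canonicalRep.t (E.H.sigmaX l y)) := fun l x y =>
    (congrArg (ψ l) (Subtype.ext (piL_theta l x y))).trans (hθ l _ _)
  -- Both sides are continuous on `K(X)` and agree on rank one operators, so the maps at the various
  -- levels combine into one map to the limit.
  have hcoh : ∀ m l (h : m ≤ l), (ρ h).comp ((ψ l).comp (mapK (E.H.piL l) (hK l))) =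
      (ψ m).comp (mapK (E.H.piL m) (hK m)) := fun m l h => by
    refine ext_K ((continuous_starAlgHom (ρ h)).comp (hcont l)) (hcont m) fun x y => ?_
    refine ((congrArg (ρ h) (hθ' l x y)).trans ?_).trans (hθ' m x y).symm
    refine (map_mul (ρ h) _ _).trans (congrArg₂ (· * ·) (ht m l h _) ?_)
    exact (map_star (ρ h) _).trans (congrArg star (ht m l h _))
  refine ⟨
    { toFun := fun T => ⟨fun l => (ψ l).comp (mapK (E.H.piL l) (hK l)) T,
        fun m l h => DFunLike.congr_fun (hcoh m l h) T⟩
      map_smul' := fun c T => Subtype.ext <| funext fun l =>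
        ((ψ l).comp (mapK (E.H.piL l) (hK l))).map_smul' c T
      map_zero' := Subtype.ext <| funext fun l => map_zero ((ψ l).comp (mapK (E.H.piL l) (hK l)))
      map_add' := fun S T => Subtype.ext <| funext fun l =>
        map_add ((ψ l).comp (mapK (E.H.piL l) (hK l))) S T
      map_mul' := fun S T => Subtype.ext <| funext fun l =>
        map_mul ((ψ l).comp (mapK (E.H.piL l) (hK l))) S T
      map_star' := fun T => Subtype.ext <| funext fun l =>
        map_star ((ψ l).comp (mapK (E.H.piL l) (hK l))) T },
    Continuous.subtype_mk (continuous_pi hcont) _,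
    fun x y => Subtype.ext <| funext fun l => hθ' l x y, fun a haJ => ?_⟩
  have haJ' : ∀ l, a ∈ E.levelIdeal l := Set.mem_iInter.1 haJ
  -- Membership of `a` in `𝒥_X` gives compactness only on each `X_l`; directedness and the density
  -- argument upgrade it to compactness on `X`, so that `ψ` can be applied to `φ(a)`.
  have haK : E.φ a ∈ E.H.K := mem_K_of_piL_mem_K E.p_mono fun l => (haJ' l).1
  refine ⟨haK, Subtype.ext <| funext fun l => ?_⟩
  obtain ⟨h, hψ⟩ := ha l _ ((piA_mem_katsuraIdeal_iff _ (hE l).1).2 (haJ' l))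
  exact (congrArg (ψ l) (Subtype.ext (level_φ_piA _ (hE l).1 a).symm)).trans hψ

end ProCStarCorrespondence

end

end ProCStar

theorem proposition5p7 {Λ : Type w} [Preorder Λ] [IsDirectedOrder Λ] [Nonempty Λ]
    (E : ProCStar.ProCStarCorrespondence.{w, u, v} Λ)
    (hE : ∀ l : Λ, E.Invariant (E.H.kerA l : Set E.H.A)) :
    ProCStar.IsInverseLimit E.toPreCorrespondence (fun l => E.level l (hE l).1)
      (fun _ _ h => E.H.piTrans (E.p_mono h)) (fun _ _ h => E.H.sigmaTrans (E.p_mono h))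
      (fun l => E.H.piA l) (fun l => E.H.sigmaX l) ∧
    (∀ l, (E.level l (hE l).1).canonicalRep.IsUniversal) ∧
    ∃ ρ : ∀ ⦃m l : Λ⦄, m ≤ l → (E.level l (hE l).1).O →⋆ₙₐ[ℂ] (E.level m (hE m).1).O,
      (∀ m l (h : m ≤ l),
        (∀ a, ρ h ((E.level l (hE l).1).canonicalRep.π a)
          = (E.level m (hE m).1).canonicalRep.π (E.H.piTrans (E.p_mono h) a)) ∧
        (∀ x, ρ h ((E.level l (hE l).1).canonicalRep.t x)
          = (E.level m (hE m).1).canonicalRep.t (E.H.sigmaTrans (E.p_mono h) x))) ∧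
      (InverseSystem fun _ _ h => ρ h) ∧
      ∃ R : ProCStar.Representation E.toPreCorrespondence (ProCStar.limitAlgebra ρ),
        R.IsCovariantOn E.covarianceIdeal ∧
        (∀ a l, (R.π a).1 l = (E.level l (hE l).1).canonicalRep.π (E.H.piA l a)) ∧
        (∀ x l, (R.t x).1 l = (E.level l (hE l).1).canonicalRep.t (E.H.sigmaX l x)) := by
  refine ⟨E.isInverseLimit_level fun l => (hE l).1, fun l =>
    ProCStar.PreCorrespondence.isUniversal_canonicalRep _, ?_⟩
  obtain ⟨ρ, hρ⟩ := E.exists_connectingMaps hE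
  have hπ := fun m l h => (hρ m l h).1
  have ht := fun m l h => (hρ m l h).2
  exact ⟨ρ, hρ, ProCStar.ProCStarCorrespondence.inverseSystem_of_generators (hE := hE) hπ ht,
    ProCStar.ProCStarCorrespondence.limitRep (hE := hE) hπ ht,
    ProCStar.ProCStarCorrespondence.limitRep_isCovariantOn (hE := hE) hπ ht,
    fun _ _ => rfl, fun _ _ => rfl⟩
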